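/- Let $0\le m\le n-1$. For $v\in\mathbb R^n$ (or a sign vector $v\in\{-,0,+\}^n$) let $\mathrm{var}(v)$ be the number of sign changes in $v$, zeros being ignored. Let $$\mathrm{Gr}^{\mathrm{var}\le m}_{1,n}=\{V\in\mathbb{RP}^{n-1} : \mathrm{var}(v)\le m\text{ for all } v\in V\}$$ be the bounded sign variation space inside the space $\mathbb{RP}^{n-1}=\mathrm{Gr}_{1,n}$ of lines through the origin in $\mathbb R^n$. For a nonzero sign vector $\omega$ (taken up to a global sign) let $U_\omega\subseteq\mathbb{RP}^{n-1}$ be the set of lines spanned by a vector with sign vector $\omega$. Then the sets $U_\omega$ with $\mathrm{var}(\omega)\le m$, where $U_\omega$ has dimension one less than the number of nonzero entries of $\omega$, are the open cells of a finite regular CW structure on $\mathrm{Gr}^{\mathrm{var}\le m}_{1,n}$; likewise, the sets $U_\omega$ for nonzero $\omega\in\{-,0,+\}^{m+1}$ are the open cells of a finite regular CW structure on $\mathbb{RP}^m$. The map $[y_1:\dots:y_{m+1}]\mapsto[0:\dots:0:y_1:\dots:y_{m+1}]$ is an embedding of $\mathbb{RP}^m$ into $\mathbb{RP}^{n-1}$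 which takes cells onto cells and whose image is a subcomplex of $\mathrm{Gr}^{\mathrm{var}\le m}_{1,n}$, and $$\mathrm{Gr}^{\mathrm{var}\le m}_{1,n}\searrow\mathbb{RP}^m,$$ i.e. the complex $\mathrm{Gr}^{\mathrm{var}\le m}_{1,n}$ collapses onto this subcomplex by a finite sequence of elementary collapses. (An elementary collapse of a regular CW complex removes an open $(d+1)$-cell $\tau$ together with an open $d$-cell $\sigma\subset\overline{\tau}$ such that $\sigma$ and $\tau$ are the only cells whose closure contains $\sigma$.) Consequently $\mathrm{Gr}^{\mathrm{var}\le m}_{1,n}$ and $\mathbb{RP}^m$ are simple-homotopy equivalent: a finite sequence of elementary collapses, inverse elementary collapses and cellular isomorphisms between finite regular CW complexes leads from one to the other. -/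

import Mathlib

open Set Topology
open scoped LinearAlgebra.Projectivization

noncomputable section

/-! ### Real projective space `Gr_{1,n} = ℝP^{n-1}` as a topological space -/

/-- The quotient topology on the space of lines through the origin. -/
instance projectivizationTopology {K V : Type*} [DivisionRing K] [AddCommGroup V] [Module K V]
    [TopologicalSpace V] : TopologicalSpace (ℙ K V) :=
  inferInstanceAs (TopologicalSpace (Quotient (projectivizationSetoid K V)))

/-- An auxiliary invariant of a line: the matrix of the orthogonal projection onto it.
It is only used to see that projective space is Hausdorff. -/
def lineProjection {n : ℕ} (p : ℙ ℝ (Fin n → ℝ)) : Fin n → Fin n → ℝ :=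
  Projectivization.lift
    (fun v i j => (v : Fin n → ℝ) i * (v : Fin n → ℝ) j / ∑ k, (v : Fin n → ℝ) k ^ 2)
    (by
      rintro ⟨a, ha⟩ ⟨b, hb⟩ t h
      have h' : a = t • b := h
      have ht : t ≠ 0 := by
        rintro rfl
        exact ha (by simpa using h')
      subst h'
      funext i j
      have e : ∑ k, (t • b) k ^ 2 = t ^ 2 * ∑ k, b k ^ 2 := by
        rw [Finset.mul_sum]
        exact Finset.sum_congr rfl fun k _ => by simp [mul_pow]
      have e2 : (t • b) i * (t • b) j = t ^ 2 * (b i * b j) := by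
        simp only [Pi.smul_apply, smul_eq_mul]; ring
      change (t • b) i * (t • b) j / ∑ k, (t • b) k ^ 2 = b i * b j / ∑ k, b k ^ 2
      rw [e, e2, mul_div_mul_left _ _ (pow_ne_zero 2 ht)]) p

theorem sum_sq_pos_of_ne_zero {n : ℕ} {v : Fin n → ℝ} (hv : v ≠ 0) : 0 < ∑ k, v k ^ 2 := by
  obtain ⟨i, hi⟩ := Function.ne_iff.mp hv
  exact Finset.sum_pos' (fun k _ => sq_nonneg (v k)) ⟨i, Finset.mem_univ i, sq_pos_of_ne_zero hi⟩

theorem continuous_lineProjection {n : ℕ} :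
    Continuous (lineProjection : ℙ ℝ (Fin n → ℝ) → Fin n → Fin n → ℝ) := by
  refine Continuous.quotient_lift (s := projectivizationSetoid ℝ (Fin n → ℝ)) ?_ _
  refine continuous_pi fun i => continuous_pi fun j => Continuous.div ?_ ?_ ?_
  · exact ((continuous_apply i).comp continuous_subtype_val).mul
      ((continuous_apply j).comp continuous_subtype_val)
  · exact continuous_finsetSum _ fun k _ =>
      ((continuous_apply k).comp continuous_subtype_val).pow 2
  · rintro ⟨v, hv⟩
    exact (sum_sq_pos_of_ne_zero hv).ne'

theorem injective_lineProjection {n : ℕ} :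
    Function.Injective (lineProjection : ℙ ℝ (Fin n → ℝ) → Fin n → Fin n → ℝ) := by
  intro p q
  induction p with | h v hv => ?_
  induction q with | h w hw => ?_
  intro h
  have key : ∀ i j, v i * v j / ∑ k, v k ^ 2 = w i * w j / ∑ k, w k ^ 2 :=
    fun i j => congrFun (congrFun h i) j
  have hv2 := (sum_sq_pos_of_ne_zero hv).ne'
  have hw2 := (sum_sq_pos_of_ne_zero hw).ne'
  obtain ⟨i, hi⟩ := Function.ne_iff.mp hv
  have hi' : v i ≠ 0 := hi
  rw [Projectivization.mk_eq_mk_iff']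
  refine ⟨(∑ k, v k ^ 2) * w i / ((∑ k, w k ^ 2) * v i), ?_⟩
  funext j
  have := key i j
  simp only [Pi.smul_apply, smul_eq_mul]
  field_simp at this ⊢
  linarith

instance t2Space_realProjectiveSpace {n : ℕ} : T2Space (ℙ ℝ (Fin n → ℝ)) :=
  T2Space.of_injective_continuous injective_lineProjection continuous_lineProjection

/-- Real projective space `ℝP^m`: the space of lines in `ℝ^(m+1)`. -/
abbrev RP (m : ℕ) : Type := ℙ ℝ (Fin (m + 1) → ℝ)

/-! ### Sign variation -/

open Classical in
/-- The sign variation of a vector (or sign vector): the number of times its entries change sign,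
zeros being ignored. A sign change is a pair of positions `i < j` with entries of strictly opposite
signs and only zeros in between. -/
def signVar {R : Type*} [Zero R] [Mul R] [LT R] {n : ℕ} (v : Fin n → R) : ℕ :=
  (Finset.univ.filter fun p : Fin n × Fin n =>
    p.1 < p.2 ∧ v p.1 * v p.2 < 0 ∧ ∀ k, p.1 < k → k < p.2 → v k = 0).card

/-- The weight of a sign vector: the number of its nonzero entries. -/
def signWeight {n : ℕ} (ω : Fin n → SignType) : ℕ :=
  (Finset.univ.filter fun i => ω i ≠ 0).card

/-- The bounded sign variation Grassmannian `Gr^{var ≤ m}_{1,n}`: the lines all of whose vectors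
have sign variation at most `m`. -/
def boundedVarGr (n m : ℕ) : Set (ℙ ℝ (Fin n → ℝ)) :=
  {p | ∀ v ∈ p.submodule, signVar v ≤ m}

/-- The cell `U_ω`: the lines spanned by a vector with sign vector `ω`.
(So `U_ω = U_{-ω}`, and `U_0` is empty.) -/
def signCell {n : ℕ} (ω : Fin n → SignType) : Set (ℙ ℝ (Fin n → ℝ)) :=
  {p | ∃ (v : Fin n → ℝ) (hv : v ≠ 0),
    Projectivization.mk ℝ v hv = p ∧ ∀ i, SignType.sign (v i) = ω i}

/-- The inclusion of `ℝ^(m+1)` into `ℝ^n` as the last `m+1` coordinates,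
`y ↦ (0, …, 0, y_1, …, y_(m+1))`. -/
def lastCoords (n m : ℕ) : (Fin (m + 1) → ℝ) →ₗ[ℝ] (Fin n → ℝ) where
  toFun y i := if hi : n ≤ i + (m + 1) then y ⟨i + (m + 1) - n, by omega⟩ else 0
  map_add' x y := by
    funext i
    by_cases hi : n ≤ i + (m + 1) <;> simp [hi]
  map_smul' c y := by
    funext i
    by_cases hi : n ≤ i + (m + 1) <;> simp [hi]

theorem lastCoords_injective {n m : ℕ} (h : m < n) :
    Function.Injective (lastCoords n m) := by
  intro x y hxy
  funext j
  have := congrFun hxy ⟨n - (m + 1) + j, by omega⟩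
  have e : n - (m + 1) + (j : ℕ) + (m + 1) - n = j := by omega
  have hle : n ≤ n - (m + 1) + (j : ℕ) + (m + 1) := by omega
  simpa [lastCoords, hle, e] using this

/-- The induced inclusion of `ℝP^m` into `ℝP^(n-1)`, with image the lines on which the first
`n - (m+1)` coordinates vanish. -/
def rpInclusion {n m : ℕ} (h : m < n) : RP m → ℙ ℝ (Fin n → ℝ) :=
  Projectivization.map (lastCoords n m) (lastCoords_injective h)

/-! ### Regular CW complexes, collapsing, simple-homotopy equivalence -/

section CW

variable {X : Type} [TopologicalSpace X]

/-- A CW complex (in a Hausdorff space) is regular if its characteristic maps are injective on the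
closed balls, hence homeomorphisms from the closed balls onto the closed cells. -/
def IsRegularCW (C : Set X) [CWComplex C] : Prop :=
  ∀ (d : ℕ) (i : RelCWComplex.cell C d),
    InjOn (RelCWComplex.map (C := C) d i) (Metric.closedBall 0 1)

/-- Let `E` be a subcomplex of a regular CW complex `C`. A `d`-cell `σ` of `E` is a free face of the
`(d+1)`-cell `τ` of `E` if `σ` lies in the closure of `τ`, and `σ` and `τ` are the only cells of `E`
whose closure contains `σ`. -/
structure IsFreeFace {C : Set X} [CWComplex C] (E : CWComplex.Subcomplex C) {d : ℕ}
    (σ : RelCWComplex.cell C d) (τ : RelCWComplex.cell C (d + 1)) : Prop where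
  mem_left : σ ∈ E.I d
  mem_right : τ ∈ E.I (d + 1)
  face : RelCWComplex.openCell (C := C) d σ ⊆ RelCWComplex.closedCell (C := C) (d + 1) τ
  free : ∀ (k : ℕ) (ρ : RelCWComplex.cell C k), ρ ∈ E.I k →
    RelCWComplex.openCell (C := C) d σ ⊆ RelCWComplex.closedCell (C := C) k ρ →
    (⟨k, ρ⟩ : Σ k, RelCWComplex.cell C k) = ⟨d, σ⟩ ∨
      (⟨k, ρ⟩ : Σ k, RelCWComplex.cell C k) = ⟨d + 1, τ⟩

/-- An elementary collapse of a subcomplex `E` to a subcomplex `F` of a regular CW complex: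
`F` is obtained from `E` by removing an open cell `τ` together with a free face `σ` of it. -/
def ElementaryCollapse {C : Set X} [CWComplex C] (E F : CWComplex.Subcomplex C) : Prop :=
  ∃ (d : ℕ) (σ : RelCWComplex.cell C d) (τ : RelCWComplex.cell C (d + 1)), IsFreeFace E σ τ ∧
    (F : Set X) = (E : Set X) \
      (RelCWComplex.openCell (C := C) d σ ∪ RelCWComplex.openCell (C := C) (d + 1) τ)

/-- `E ↘ F`: the subcomplex `E` collapses onto `F` by finitely many elementary collapses. -/
def Collapses {C : Set X} [CWComplex C] : CWComplex.Subcomplex C → CWComplex.Subcomplex C → Prop :=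
  Relation.ReflTransGen ElementaryCollapse

end CW

/-- A finite regular CW complex. -/
structure FiniteRegularCW where
  space : Type
  [topology : TopologicalSpace space]
  [hausdorff : T2Space space]
  complex : Set space
  [cw : CWComplex complex]
  finite : RelCWComplex.Finite complex
  regular : IsRegularCW complex

namespace FiniteRegularCW

attribute [instance] topology hausdorff cw

/-- A subcomplex of a finite regular CW complex, as a finite regular CW complex. -/
def ofSubcomplex (K : FiniteRegularCW) (E : CWComplex.Subcomplex K.complex) :
    FiniteRegularCW where
  space := K.space
  complex := (E : Set K.space)
  finite := by
    have := K.finite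
    exact RelCWComplex.Subcomplex.finite_subcomplex_of_finite E
  regular := fun d (i : E.I d) => K.regular d i.1

/-- Cellular isomorphism: a homeomorphism under which the open `d`-cells correspond, for all `d`. -/
def Iso (K L : FiniteRegularCW) : Prop :=
  ∃ f : K.complex ≃ₜ L.complex, ∀ (d : ℕ) (s : Set K.complex),
    (∃ i, Subtype.val '' s = RelCWComplex.openCell (C := K.complex) d i) ↔
      ∃ j, Subtype.val '' (f '' s) = RelCWComplex.openCell (C := L.complex) d j

/-- `L` is, up to cellular isomorphism, obtained from `K` by an elementary collapse. -/
def CollapseStep (K L : FiniteRegularCW) : Prop :=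
  ∃ T E : CWComplex.Subcomplex K.complex, (T : Set K.space) = K.complex ∧
    ElementaryCollapse T E ∧ Iso (K.ofSubcomplex E) L

/-- Simple-homotopy equivalence of finite regular CW complexes: the equivalence relation generated
by cellular isomorphisms and elementary collapses. So `K` and `L` are related if and only if a
finite sequence of elementary collapses, their inverses (elementary expansions) and cellular
isomorphisms leads from `K` to `L`. -/
def SimpleHomotopyEquivalent : FiniteRegularCW → FiniteRegularCW → Prop :=
  Relation.EqvGen fun K L => Iso K L ∨ CollapseStep K L

end FiniteRegularCW

/-- The given CW structure on `C ⊆ ℝP^(n-1)` is finite and regular and, for every `d`, its open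
`d`-cells are exactly the sets `U_ω` with `ω` of weight `d + 1` and `var ω ≤ m`. -/
structure IsSignDecomposition {n : ℕ} (m : ℕ) (C : Set (ℙ ℝ (Fin n → ℝ))) [CWComplex C] :
    Prop where
  finite : RelCWComplex.Finite C
  regular : IsRegularCW C
  openCell_iff : ∀ (d : ℕ) (s : Set (ℙ ℝ (Fin n → ℝ))),
    (∃ i : RelCWComplex.cell C d, RelCWComplex.openCell (C := C) d i = s) ↔
      ∃ ω : Fin n → SignType, signWeight ω = d + 1 ∧ signVar ω ≤ m ∧ signCell ω = s

/-- The finite regular CW complex given by a decomposition into the cells `U_ω`. -/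
def IsSignDecomposition.toFiniteRegularCW {n m : ℕ} {C : Set (ℙ ℝ (Fin n → ℝ))} [CWComplex C]
    (h : IsSignDecomposition m C) : FiniteRegularCW where
  space := ℙ ℝ (Fin n → ℝ)
  complex := C
  finite := h.finite
  regular := h.regular

end

/-!
The lines spanned by vectors with a given sign vector `ω` of weight `d + 1` form the interior of a
`d`-simplex in the affine chart `∑ ω_i v_i = 1`, and in this chart the closed simplex consists of
the lines whose sign vector is, up to a global sign, obtained from `ω` by replacing entries by zero.
The chart is injective (`injective_signChart`), so closed cells are embedded simplices. Passing to
such a face does not increase the sign variation (`SignFace.signVar_le`), so the cells with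
variation at most `m` fit together to a finite regular CW complex (`signCW`). Its characteristic
maps are defined on cubes, which a convex rescaling identifies with simplices.

The cells are indexed by the sign vectors whose first nonzero entry is `+`. For the collapse,
consider such an `ω` with a nonzero entry outside the last `m + 1` positions, and let `p` be the
first nonzero position. If the entries of `ω` alternated from `p` to the end, there would be more
than `m` sign changes. So there is a first position `i > p` at which the alternation breaks, and
`ω i` is either `0` or `ω (i - 1)`. Exchanging these two values does not change the variation, and
it defines a perfect matching of the cells outside the last `m + 1` positions (`IsMatchPos`). It is
acyclic: passing to a larger cell moves `p` to the left, or keeps `p` and moves `i` to the right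
(`IsMatchPos.compare`), or keeps both and increases the weight. Hence in every subcomplex that
contains the target and is a union of matched pairs outside it, a pair that is extremal in this
sense is free (`IsSaturated.exists_free_pair`), and removing the pairs one after the other is the
collapse (`IsSaturated.collapses`). What remains are the cells supported on the last `m + 1`
positions, which make up the image of `ℝP^m` (`range_rpInclusion`).
-/

/-! ### Sign vectors and their faces -/

section SignVectors

variable {n : ℕ}

/-- `σ` is a face of `ρ`: it arises from `ρ` by replacing some entries by zero. -/
def SignFace (σ ρ : Fin n → SignType) : Prop := ∀ i, σ i = 0 ∨ σ i = ρ i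

/-- The face relation on sign vectors up to a global sign. -/
def ProjFace (σ ρ : Fin n → SignType) : Prop := SignFace σ ρ ∨ SignFace (-σ) ρ

/-- A sign vector is normalized if its first nonzero entry is `+`. Every nonzero sign vector is
normalized up to a global sign, so that normalized sign vectors index the cells `U_ω`. -/
def IsNormalized (ω : Fin n → SignType) : Prop := ∃ p, ω p = 1 ∧ ∀ k < p, ω k = 0

theorem SignFace.refl (σ : Fin n → SignType) : SignFace σ σ := fun _ => Or.inr rfl

theorem SignFace.eq_of_ne_zero {σ ρ : Fin n → SignType} (h : SignFace σ ρ) {i : Fin n}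
    (hi : σ i ≠ 0) : σ i = ρ i := (h i).resolve_left hi

theorem SignFace.ne_zero {σ ρ : Fin n → SignType} (h : SignFace σ ρ) {i : Fin n}
    (hi : σ i ≠ 0) : ρ i ≠ 0 := h.eq_of_ne_zero hi ▸ hi

theorem SignFace.trans {σ ρ τ : Fin n → SignType} (h : SignFace σ ρ) (h' : SignFace ρ τ) :
    SignFace σ τ := fun i => by
  rcases h i with h1 | h1
  · exact Or.inl h1
  · rcases h' i with h2 | h2
    · exact Or.inl (h1.trans h2)
    · exact Or.inr (h1.trans h2)

theorem SignFace.neg {σ ρ : Fin n → SignType} (h : SignFace σ ρ) : SignFace (-σ) (-ρ) := fun i => by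
  rcases h i with h1 | h1
  · exact Or.inl (by simp [h1])
  · exact Or.inr (by simp [h1])

theorem ProjFace.ne_zero {σ ρ : Fin n → SignType} (h : ProjFace σ ρ) {i : Fin n}
    (hi : σ i ≠ 0) : ρ i ≠ 0 := by
  rcases h with h | h
  · exact h.ne_zero hi
  · exact h.ne_zero (by simpa using hi)

theorem ProjFace.trans {σ ρ τ : Fin n → SignType} (h : ProjFace σ ρ) (h' : ProjFace ρ τ) :
    ProjFace σ τ := by
  rcases h with h | h <;> rcases h' with h' | h'
  · exact Or.inl (h.trans h')
  · exact Or.inr (h.neg.trans h')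
  · exact Or.inr (h.trans h')
  · exact Or.inl (by simpa using h.neg.trans h')

theorem IsNormalized.ne_zero {ω : Fin n → SignType} (h : IsNormalized ω) : ω ≠ 0 := by
  rintro rfl
  obtain ⟨p, hp, -⟩ := h
  simp at hp

theorem isNormalized_or_neg {ω : Fin n → SignType} (h : ω ≠ 0) :
    IsNormalized ω ∨ IsNormalized (-ω) := by
  obtain ⟨i, hi⟩ := Function.ne_iff.mp h
  have hne : (Finset.univ.filter fun i => ω i ≠ 0).Nonempty := ⟨i, by simpa using hi⟩
  obtain ⟨p, hp, hmin⟩ := Finset.exists_min_image _ id hne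
  have hz : ∀ k < p, ω k = 0 := fun k hk => by
    by_contra h0
    exact absurd (hmin k (by simpa using h0)) (not_le.mpr hk)
  rcases SignType.trichotomy (ω p) with h1 | h1 | h1
  · exact Or.inr ⟨p, by simp [h1], fun k hk => by simp [hz k hk]⟩
  · simp [h1] at hp
  · exact Or.inl ⟨p, h1, hz⟩

theorem IsNormalized.not_neg {ω : Fin n → SignType} (h : IsNormalized ω) :
    ¬ IsNormalized (-ω) := by
  rintro ⟨q, hq, hq'⟩
  obtain ⟨p, hp, hp'⟩ := h
  rcases lt_trichotomy p q with h | rfl | h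
  · have := hq' p h
    simp [hp] at this
  · simp [hp] at hq
  · have := hp' q h
    simp [this] at hq

/-! ### Weight -/

theorem signWeight_neg (ω : Fin n → SignType) : signWeight (-ω) = signWeight ω := by
  simp [signWeight]

theorem signWeight_pos {ω : Fin n → SignType} (h : ω ≠ 0) : 0 < signWeight ω := by
  obtain ⟨i, hi⟩ := Function.ne_iff.mp h
  exact Finset.card_pos.mpr ⟨i, by simpa using hi⟩

theorem SignFace.eq_of_signWeight_le {σ ρ : Fin n → SignType} (h : SignFace σ ρ)
    (hw : signWeight ρ ≤ signWeight σ) : σ = ρ := by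
  have hs := Finset.eq_of_subset_of_card_le
    (s := Finset.univ.filter fun i => σ i ≠ 0) (t := Finset.univ.filter fun i => ρ i ≠ 0)
    (fun i hi => by simpa using h.ne_zero (by simpa using hi)) hw
  funext i
  rcases h i with h0 | h0
  · by_contra hne
    have : i ∈ Finset.univ.filter fun i => ρ i ≠ 0 := by
      simpa using fun h1 => hne (h0.trans h1.symm)
    rw [← hs] at this
    simp [h0] at this
  · exact h0

theorem signWeight_update {σ : Fin n → SignType} {i : Fin n} (hi : σ i = 0) {s : SignType}
    (hs : s ≠ 0) : signWeight (Function.update σ i s) = signWeight σ + 1 := by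
  unfold signWeight
  rw [← Finset.card_insert_of_notMem (a := i) (by simp [hi])]
  congr 1
  ext k
  by_cases hk : k = i
  · subst hk; simp [hs]
  · simp [hk]

/-! ### Sign changes -/

/-- The entries of `v` at `a < b` have opposite signs, with only zeros in between. -/
def IsSignChange {R : Type*} [Zero R] [Mul R] [LT R] (v : Fin n → R) (a b : Fin n) : Prop :=
  a < b ∧ v a * v b < 0 ∧ ∀ k, a < k → k < b → v k = 0

open Classical in
theorem signVar_eq_card {R : Type*} [Zero R] [Mul R] [LT R] (v : Fin n → R) :
    signVar v = (Finset.univ.filter fun q : Fin n × Fin n => IsSignChange v q.1 q.2).card := by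
  refine congrArg Finset.card (Finset.ext fun q => ?_)
  rw [Finset.mem_filter, Finset.mem_filter]
  rfl

theorem signVar_sign (v : Fin n → ℝ) : signVar (fun i => SignType.sign (v i)) = signVar v := by
  classical
  rw [signVar_eq_card, signVar_eq_card]
  refine congrArg Finset.card (Finset.ext fun q => ?_)
  rw [Finset.mem_filter, Finset.mem_filter]
  simp only [Finset.mem_univ, true_and, IsSignChange, sign_eq_zero_iff,
    ← sign_mul, SignType.neg_iff, sign_eq_neg_one_iff]

theorem signVar_neg (ω : Fin n → SignType) : signVar (-ω) = signVar ω := by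
  classical
  rw [signVar_eq_card, signVar_eq_card]
  congr 1
  ext q
  simp [IsSignChange]

theorem IsSignChange.ne_zero {ω : Fin n → SignType} {a b : Fin n} (h : IsSignChange ω a b) :
    ω a ≠ 0 ∧ ω b ≠ 0 := by
  have := h.2.1
  constructor <;> intro h0 <;> simp [h0] at this

/-- Between two entries of opposite signs there is a sign change. -/
theorem exists_isSignChange (ω : Fin n → SignType) :
    ∀ (N : ℕ) (a b : Fin n), (b : ℕ) ≤ a + N → a < b → ω a * ω b < 0 →
      ∃ a' b', a ≤ a' ∧ b' ≤ b ∧ IsSignChange ω a' b' := by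
  intro N
  induction N with
  | zero => intro a b h1 h2; exact absurd h2 (not_lt.mpr h1)
  | succ N ih =>
    intro a b hN hab hneg
    by_cases hz : ∀ k, a < k → k < b → ω k = 0
    · exact ⟨a, b, le_rfl, le_rfl, hab, hneg, hz⟩
    push Not at hz
    obtain ⟨k, hak, hkb, hk⟩ := hz
    have hor : ω a * ω k < 0 ∨ ω k * ω b < 0 := by
      revert hneg hk
      generalize ω a = x
      generalize ω b = y
      generalize ω k = z
      revert x y z
      decide
    have h1 : (a : ℕ) < k := hak
    have h2 : (k : ℕ) < b := hkb
    rcases hor with h | h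
    · obtain ⟨a', b', h3, h4, h5⟩ := ih a k (by omega) hak h
      exact ⟨a', b', h3, h4.trans hkb.le, h5⟩
    · obtain ⟨a', b', h3, h4, h5⟩ := ih k b (by omega) hkb h
      exact ⟨a', b', hak.le.trans h3, h4, h5⟩

/-- Two sign changes whose intervals contain a common interval `[c, d]` coincide. -/
theorem IsSignChange.eq_of_common {ω : Fin n → SignType} {a b a' b' c d : Fin n}
    (h : IsSignChange ω a b) (h' : IsSignChange ω a' b') (hcd : c < d)
    (h1 : a ≤ c) (h2 : d ≤ b) (h3 : a' ≤ c) (h4 : d ≤ b') : a = a' ∧ b = b' := by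
  have key : ∀ x y z w : Fin n, IsSignChange ω x y → IsSignChange ω z w → z ≤ c → d ≤ y →
      x ≤ c → d ≤ w → ¬ x < z ∧ ¬ y < w := by
    intro x y z w hx hz hzc hdy hxc hdw
    refine ⟨fun hlt => ?_, fun hlt => ?_⟩
    · exact hz.ne_zero.1 (hx.2.2 z hlt (hzc.trans_lt (hcd.trans_le hdy)))
    · exact hx.ne_zero.2 (hz.2.2 y (hzc.trans_lt (hcd.trans_le hdy)) hlt)
  have k1 := key a b a' b' h h' h3 h2 h1 h4
  have k2 := key a' b' a b h' h h1 h4 h3 h2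
  exact ⟨le_antisymm (not_lt.mp k2.1) (not_lt.mp k1.1),
    le_antisymm (not_lt.mp k2.2) (not_lt.mp k1.2)⟩

/-- Passing to a face does not increase the sign variation. -/
theorem SignFace.signVar_le {σ ρ : Fin n → SignType} (h : SignFace σ ρ) :
    signVar σ ≤ signVar ρ := by
  classical
  rw [signVar_eq_card, signVar_eq_card]
  have hex : ∀ q : Fin n × Fin n, IsSignChange σ q.1 q.2 →
      ∃ r : Fin n × Fin n, q.1 ≤ r.1 ∧ r.2 ≤ q.2 ∧ IsSignChange ρ r.1 r.2 := by
    rintro ⟨a, b⟩ hq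
    have hab := hq.2.1
    rw [h.eq_of_ne_zero hq.ne_zero.1, h.eq_of_ne_zero hq.ne_zero.2] at hab
    obtain ⟨a', b', h1, h2, h3⟩ := exists_isSignChange ρ b a b (by omega) hq.1 hab
    exact ⟨(a', b'), h1, h2, h3⟩
  choose! f hf using hex
  refine Finset.card_le_card_of_injOn f ?_ ?_
  · intro q hq
    simp only [Finset.coe_filter, Finset.mem_univ, true_and, Set.mem_ofPred_eq] at hq ⊢
    exact (hf q hq).2.2
  · intro q hq r hr hqr
    simp only [Finset.coe_filter, Finset.mem_univ, true_and, Set.mem_ofPred_eq] at hq hr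
    obtain ⟨q1, q2, q3⟩ := hf q hq
    obtain ⟨r1, r2, -⟩ := hf r hr
    rw [← hqr] at r1 r2
    exact Prod.ext_iff.mpr (hq.eq_of_common hr q3.1 q1 q2 r1 r2)

theorem ProjFace.signVar_le {σ ρ : Fin n → SignType} (h : ProjFace σ ρ) :
    signVar σ ≤ signVar ρ := by
  rcases h with h | h
  · exact h.signVar_le
  · rw [← signVar_neg]; exact h.signVar_le

/-- Filling a zero with a copy of its left neighbour does not increase the sign variation. -/
theorem signVar_update_le {σ : Fin n → SignType} {i j : Fin n} (hij : (j : ℕ) + 1 = i)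
    (hi : σ i = 0) (hj : σ j ≠ 0) :
    signVar (Function.update σ i (σ j)) ≤ signVar σ := by
  classical
  have hji : j ≠ i := fun h => by rw [h] at hij; omega
  have hjlt : j < i := Fin.lt_def.mpr (by omega)
  rw [signVar_eq_card, signVar_eq_card]
  set τ := Function.update σ i (σ j) with hτ
  have hτi : τ i = σ j := by simp [hτ]
  have hτk : ∀ k, k ≠ i → τ k = σ k := fun k hk => by simp [hτ, hk]
  have hz : ∀ k, τ k = 0 → σ k = 0 := fun k hk => by
    by_cases h : k = i
    · rw [h, hi]
    · rwa [← hτk k h]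
  have hb : ∀ a b, IsSignChange τ a b → b ≠ i := by
    rintro a b hab rfl
    by_cases haj : a = j
    · have := hab.2.1
      rw [haj, hτi, hτk j hji] at this
      revert this
      generalize σ j = x
      revert x
      decide
    · have h1 : a < j := lt_of_le_of_ne (Fin.le_def.mpr (by
        have : (a : ℕ) < b := hab.1
        omega)) haj
      exact hj (by rw [← hτk j hji]; exact hab.2.2 j h1 hjlt)
  refine Finset.card_le_card_of_injOn (fun q => (if q.1 = i then j else q.1, q.2)) ?_ ?_
  · rintro ⟨a, b⟩ hq
    simp only [Finset.coe_filter, Finset.mem_univ, true_and, Set.mem_ofPred_eq] at hq ⊢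
    have hbi := hb a b hq
    by_cases ha : a = i
    · subst ha
      simp only [if_true]
      refine ⟨hjlt.trans hq.1, ?_, fun k h1 h2 => ?_⟩
      · have := hq.2.1
        rwa [hτi, hτk b hbi] at this
      · by_cases hk : k = a
        · rw [hk, hi]
        · refine hz k (hq.2.2 k (lt_of_le_of_ne (Fin.le_def.mpr ?_) (Ne.symm hk)) h2)
          have : (j : ℕ) < k := h1
          omega
    · simp only [if_neg ha]
      refine ⟨hq.1, ?_, fun k h1 h2 => hz k (hq.2.2 k h1 h2)⟩
      have := hq.2.1
      rwa [hτk a ha, hτk b hbi] at this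
  · have hno : ∀ b, IsSignChange τ i b → ¬ IsSignChange τ j b := fun b h1 h2 =>
      h1.ne_zero.1 (h2.2.2 i hjlt h1.1)
    rintro ⟨a, b⟩ hq ⟨a', b'⟩ hr hqr
    simp only [Finset.coe_filter, Finset.mem_univ, true_and, Set.mem_ofPred_eq] at hq hr
    simp only [Prod.mk.injEq] at hqr
    obtain ⟨h1, rfl⟩ := hqr
    by_cases ha : a = i <;> by_cases ha' : a' = i
    · rw [ha, ha']
    · rw [if_pos ha, if_neg ha'] at h1
      subst ha h1
      exact absurd hr (hno b hq)
    · rw [if_neg ha, if_pos ha'] at h1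
      subst ha' h1
      exact absurd hq (hno b hr)
    · rw [if_neg ha, if_neg ha'] at h1
      rw [h1]

/-- A sign vector that alternates from position `p` to the end has at least `n - 1 - p` sign
changes. -/
theorem le_signVar_of_alternating {ω : Fin n → SignType} {p : Fin n}
    (h : ∀ k, p ≤ k → ω k = (-1) ^ ((k : ℕ) + p)) : n ≤ signVar ω + p + 1 := by
  classical
  rw [signVar_eq_card]
  have hp := p.2
  have hc : (Finset.univ : Finset (Fin (n - 1 - p))).card ≤
      (Finset.univ.filter fun q : Fin n × Fin n => IsSignChange ω q.1 q.2).card := by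
    refine Finset.card_le_card_of_injOn
      (fun k => (⟨p + k, by omega⟩, ⟨p + k + 1, by omega⟩)) ?_ ?_
    · intro k _
      simp only [Finset.coe_filter, Finset.mem_univ, true_and, Set.mem_ofPred_eq]
      refine ⟨Fin.lt_def.mpr (by simp), ?_, fun l h1 h2 => ?_⟩
      · rw [h _ (Fin.le_def.mpr (by simp)), h _ (Fin.le_def.mpr (by simp; omega))]
        simp only
        rw [show (p : ℕ) + k + 1 + p = (p + k + p) + 1 by ring, pow_succ, ← mul_assoc, ← mul_pow]
        simp
      · have h1 : (p : ℕ) + k < l := h1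
        have h2 : (l : ℕ) < p + k + 1 := h2
        omega
    · intro a _ b _ hab
      simp only [Prod.mk.injEq, Fin.mk.injEq] at hab
      exact Fin.ext (by omega)
  simp only [Finset.card_univ, Fintype.card_fin] at hc
  omega

end SignVectors

/-! ### The matching on sign vectors -/

section Matching

variable {n : ℕ}

/-- The matching position of a sign vector: the first nonzero entry of `ω` is `ω p = +`, the
entries from `p` on alternate strictly before position `i`, and this alternation breaks at `i`, so
that `ω i` is either zero or a repetition of `ω (i - 1)`. The matching exchanges these two values.
The sign `(-1) ^ (k + p)` stands for `(-1) ^ (k - p)`. -/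
structure IsMatchPos (ω : Fin n → SignType) (p i : Fin n) : Prop where
  lt : p < i
  zero_of_lt : ∀ k < p, ω k = 0
  alternating : ∀ k, p ≤ k → k < i → ω k = (-1) ^ ((k : ℕ) + p)
  ne : ω i ≠ (-1) ^ ((i : ℕ) + p)

theorem signType_neg_one_pow_ne_zero (k : ℕ) : (-1 : SignType) ^ k ≠ 0 := pow_ne_zero k (by decide)

namespace IsMatchPos

variable {ω σ ρ : Fin n → SignType} {p i q j : Fin n}

theorem apply_first (h : IsMatchPos ω p i) : ω p = 1 := by
  rw [h.alternating p le_rfl h.lt, ← two_mul, pow_mul]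
  simp

theorem isNormalized (h : IsMatchPos ω p i) : IsNormalized ω := ⟨p, h.apply_first, h.zero_of_lt⟩

theorem apply_eq (h : IsMatchPos ω p i) : ω i = 0 ∨ ω i = (-1) ^ ((i : ℕ) + p + 1) := by
  have := h.ne
  rw [pow_succ]
  revert this
  rcases neg_one_pow_eq_or SignType ((i : ℕ) + p) with h | h <;> rw [h] <;>
    generalize ω i = x <;> revert x <;> decide

/-- The matching position does not depend on which of the two admissible values is at `i`. -/
theorem update (h : IsMatchPos ω p i) {s : SignType} (hs : s ≠ (-1) ^ ((i : ℕ) + p)) :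
    IsMatchPos (Function.update ω i s) p i where
  lt := h.lt
  zero_of_lt k hk := by
    rw [Function.update_of_ne (hk.trans h.lt).ne, h.zero_of_lt k hk]
  alternating k h1 h2 := by
    rw [Function.update_of_ne h2.ne, h.alternating k h1 h2]
  ne := by simpa using hs

theorem update_zero (h : IsMatchPos ω p i) : IsMatchPos (Function.update ω i 0) p i :=
  h.update (signType_neg_one_pow_ne_zero _).symm

theorem update_upper (h : IsMatchPos ω p i) :
    IsMatchPos (Function.update ω i ((-1) ^ ((i : ℕ) + p + 1))) p i :=
  h.update (by
    rw [pow_succ]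
    rcases neg_one_pow_eq_or SignType ((i : ℕ) + p) with h | h <;> rw [h] <;> decide)

/-- Towards larger sign vectors the first nonzero position decreases or, if it stays the same, the
alternating run does not get shorter. This makes the matching acyclic. -/
theorem compare (hσ : IsMatchPos σ p i) (hρ : IsMatchPos ρ q j) (h : ProjFace σ ρ) :
    q < p ∨ (q = p ∧ i ≤ j ∧ SignFace σ ρ) := by
  have hp : σ p ≠ 0 := by rw [hσ.apply_first]; decide
  have hqp : q ≤ p := by
    by_contra hlt
    exact h.ne_zero hp (hρ.zero_of_lt p (not_le.mp hlt))
  rcases hqp.lt_or_eq with hlt | rfl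
  · exact Or.inl hlt
  refine Or.inr ⟨rfl, ?_, ?_⟩
  all_goals
    have hf : SignFace σ ρ := by
      refine h.resolve_right fun hn => ?_
      have := hn.eq_of_ne_zero (i := q) (by simpa using hp)
      rw [Pi.neg_apply, hσ.apply_first, hρ.apply_first] at this
      exact absurd this (by decide)
  · by_contra hlt
    have hj := hσ.alternating j hρ.lt.le (not_le.mp hlt)
    have hj0 : σ j ≠ 0 := by rw [hj]; exact signType_neg_one_pow_ne_zero _
    exact hρ.ne ((hf.eq_of_ne_zero hj0).symm.trans hj)
  · exact hf

theorem unique (h : IsMatchPos ω p i) (h' : IsMatchPos ω q j) : p = q ∧ i = j := by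
  have hr : ProjFace ω ω := Or.inl (SignFace.refl ω)
  rcases h.compare h' hr with h1 | ⟨h1, h2, -⟩ <;> rcases h'.compare h hr with h3 | ⟨h3, h4, -⟩
  · exact absurd h1 h3.not_gt
  · exact absurd h3 h1.ne'
  · exact absurd h1 h3.ne'
  · exact ⟨h3, le_antisymm h2 h4⟩

/-- Matched sign vectors have the same sign variation. -/
theorem signVar_update_upper_le (h : IsMatchPos σ p i) (hi : σ i = 0) :
    signVar (Function.update σ i ((-1) ^ ((i : ℕ) + p + 1))) ≤ signVar σ := by
  have hlt : (p : ℕ) < i := h.lt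
  -- The upper value at `i` is a copy of the entry at `i - 1`.
  let k : Fin n := ⟨i - 1, by omega⟩
  have hk : σ k = (-1) ^ ((i : ℕ) + p + 1) := by
    rw [h.alternating k (Fin.le_def.mpr (by simp only [k]; omega))
      (Fin.lt_def.mpr (by simp only [k]; omega)), ← mul_one ((-1) ^ ((k : ℕ) + p)),
      show (i : ℕ) + p + 1 = (k + p) + 2 by simp only [k]; omega, pow_add _ _ 2]
    congr 1
  rw [← hk]
  exact signVar_update_le (by simp only [k]; omega) hi
    (by rw [hk]; exact signType_neg_one_pow_ne_zero _)

end IsMatchPos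

/-- A sign vector with a nonzero entry outside the last `m + 1` positions and with sign variation
at most `m` cannot alternate to the end, so it is matched. -/
theorem IsNormalized.exists_isMatchPos {m : ℕ} {ω : Fin n → SignType} (hω : IsNormalized ω)
    (hvar : signVar ω ≤ m) (hk : ∃ k : Fin n, (k : ℕ) + m + 1 < n ∧ ω k ≠ 0) :
    ∃ p i : Fin n, (p : ℕ) + m + 1 < n ∧ IsMatchPos ω p i := by
  obtain ⟨p, hp, hp'⟩ := hω
  obtain ⟨k, hk, hk0⟩ := hk
  have hpk : p ≤ k := by
    by_contra hlt
    exact hk0 (hp' k (not_le.mp hlt))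
  have hpm : (p : ℕ) + m + 1 < n := by
    have : (p : ℕ) ≤ k := hpk
    omega
  have hex : (Finset.univ.filter fun i : Fin n => p ≤ i ∧ ω i ≠ (-1) ^ ((i : ℕ) + p)).Nonempty := by
    by_contra hne
    rw [Finset.not_nonempty_iff_eq_empty, Finset.filter_eq_empty_iff] at hne
    have := le_signVar_of_alternating (ω := ω) (p := p) fun i hi => by
      by_contra h0
      exact hne (Finset.mem_univ i) ⟨hi, h0⟩
    omega
  obtain ⟨i, hi, hmin⟩ := Finset.exists_min_image _ id hex
  simp only [Finset.mem_filter, Finset.mem_univ, true_and, id] at hi hmin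
  refine ⟨p, i, hpm, lt_of_le_of_ne hi.1 ?_, hp', fun l h1 h2 => ?_, hi.2⟩
  · rintro rfl
    refine hi.2 ?_
    rw [hp, ← two_mul, pow_mul]
    simp
  · by_contra h0
    exact absurd (hmin l ⟨h1, h0⟩) (not_le.mpr h2)

end Matching

/-! ### Collapsing order on sets of sign vectors -/

section CollapsibleFamily

variable {n m : ℕ}

/-- The sign vectors supported on the last `m + 1` positions. -/
def IsLast (m : ℕ) (ω : Fin n → SignType) : Prop := ∀ k : Fin n, (k : ℕ) + m + 1 < n → ω k = 0

theorem IsLast.of_projFace {σ ρ : Fin n → SignType} (h : IsLast m ρ) (hf : ProjFace σ ρ) :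
    IsLast m σ := fun k hk => by
  by_contra h0
  exact hf.ne_zero h0 (h k hk)

theorem IsMatchPos.not_isLast {ω : Fin n → SignType} {p i : Fin n} (h : IsMatchPos ω p i)
    (hp : (p : ℕ) + m + 1 < n) : ¬ IsLast m ω := fun hl => by
  have := hl p hp
  rw [h.apply_first] at this
  exact absurd this (by decide)

/-- A set of (indices of) cells forming a subcomplex of the bounded sign variation space: it
consists of normalized sign vectors of variation at most `m` and is closed under faces. -/
structure IsCellFamily (m : ℕ) (S : Set (Fin n → SignType)) : Prop where
  isNormalized : ∀ ω ∈ S, IsNormalized ω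
  signVar_le : ∀ ω ∈ S, signVar ω ≤ m
  mem_of_face : ∀ ω ∈ S, ∀ σ, IsNormalized σ → ProjFace σ ω → σ ∈ S

/-- A family of cells is saturated if it contains all cells supported on the last `m + 1` positions
and is closed under the matching of the remaining ones. -/
structure IsSaturated (m : ℕ) (S : Set (Fin n → SignType)) : Prop extends IsCellFamily m S where
  mem_of_isLast : ∀ ω, IsNormalized ω → signVar ω ≤ m → IsLast m ω → ω ∈ S
  mem_of_match : ∀ ω ∈ S, ∀ p i : Fin n, (p : ℕ) + m + 1 < n → IsMatchPos ω p i → ω i = 0 →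
    Function.update ω i ((-1) ^ ((i : ℕ) + p + 1)) ∈ S

theorem isSaturated_all (n m : ℕ) :
    IsSaturated m {ω : Fin n → SignType | IsNormalized ω ∧ signVar ω ≤ m} where
  isNormalized _ h := h.1
  signVar_le _ h := h.2
  mem_of_face _ h _ hσ hf := ⟨hσ, hf.signVar_le.trans h.2⟩
  mem_of_isLast _ h1 h2 _ := ⟨h1, h2⟩
  mem_of_match _ h _ _ _ hi h0 :=
    ⟨hi.update_upper.isNormalized, (hi.signVar_update_upper_le h0).trans h.2⟩

theorem isCellFamily_isLast (n m : ℕ) :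
    IsCellFamily m {ω : Fin n → SignType | IsNormalized ω ∧ signVar ω ≤ m ∧ IsLast m ω} where
  isNormalized _ h := h.1
  signVar_le _ h := h.2.1
  mem_of_face _ h _ hσ hf := ⟨hσ, hf.signVar_le.trans h.2.1, h.2.2.of_projFace hf⟩

/-- A saturated family with cells outside the last `m + 1` positions contains a matched pair whose
lower member is a free face of the upper one, and removing it leaves a saturated family. The pair
is found by maximizing, in lexicographic order, minus the first nonzero position, the length of the
alternating run, and the weight. -/
theorem IsSaturated.exists_free_pair {S : Set (Fin n → SignType)} (hS : IsSaturated m S)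
    (hne : ∃ ω ∈ S, ¬ IsLast m ω) :
    ∃ σ ∈ S, ∃ τ ∈ S, SignFace σ τ ∧ signWeight τ = signWeight σ + 1 ∧
      (∀ ρ ∈ S, ProjFace σ ρ → ρ = σ ∨ ρ = τ) ∧ IsSaturated m (S \ {σ, τ}) := by
  classical
  let P : Finset (Fin n × Fin n × (Fin n → SignType)) := Finset.univ.filter fun x =>
    (x.1 : ℕ) + m + 1 < n ∧ x.2.2 ∈ S ∧ IsMatchPos x.2.2 x.1 x.2.1 ∧ x.2.2 x.2.1 = 0
  -- `P` consists of the lower members of the matched pairs in `S`, with their positions.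
  have lower_mem : ∀ ρ ∈ S, ∀ q j : Fin n, (q : ℕ) + m + 1 < n → IsMatchPos ρ q j →
      (q, j, Function.update ρ j 0) ∈ P := by
    intro ρ hρ q j hq h
    simp only [P, Finset.mem_filter, Finset.mem_univ, true_and]
    refine ⟨hq, hS.mem_of_face ρ hρ _ h.update_zero.isNormalized (Or.inl fun k => ?_),
      h.update_zero, by simp⟩
    by_cases hk : k = j
    · subst hk; simp
    · simp [hk]
  have match_of : ∀ ρ ∈ S, ¬ IsLast m ρ →
      ∃ q j : Fin n, (q : ℕ) + m + 1 < n ∧ IsMatchPos ρ q j := by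
    intro ρ hρ hl
    refine (hS.isNormalized ρ hρ).exists_isMatchPos (hS.signVar_le ρ hρ) ?_
    unfold IsLast at hl
    push Not at hl
    exact hl
  have hP : P.Nonempty := by
    obtain ⟨ω, hω, hl⟩ := hne
    obtain ⟨q, j, hq, h⟩ := match_of ω hω hl
    exact ⟨_, lower_mem ω hω q j hq h⟩
  let key : Fin n × Fin n × (Fin n → SignType) → ℕ ×ₗ (ℕ ×ₗ ℕ) := fun x =>
    toLex (n - x.1, toLex ((x.2.1 : ℕ), signWeight x.2.2))
  obtain ⟨⟨p, i, σ⟩, hmem, hmax⟩ := Finset.exists_max_image P key hP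
  simp only [P, Finset.mem_filter, Finset.mem_univ, true_and] at hmem
  obtain ⟨hp, hσ, hpos, hi⟩ := hmem
  have hτ := hS.mem_of_match σ hσ p i hp hpos hi
  set τ := Function.update σ i ((-1) ^ ((i : ℕ) + p + 1)) with hτdef
  have hτpos : IsMatchPos τ p i := hpos.update_upper
  have hτi : τ i ≠ 0 := by simp [hτdef]
  have hστ : SignFace σ τ := fun k => by
    by_cases hk : k = i
    · subst hk; exact Or.inl hi
    · right; simp [hτdef, hk]
  have hfree : ∀ ρ ∈ S, ProjFace σ ρ → ρ = σ ∨ ρ = τ := by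
    intro ρ hρ hf
    obtain ⟨q, j, hq, h⟩ := match_of ρ hρ fun hl => hpos.not_isLast hp (hl.of_projFace hf)
    have hle := hmax _ (lower_mem ρ hρ q j hq h)
    simp only [key, Prod.Lex.toLex_le_toLex] at hle
    have hpn := p.2
    have hqn := q.2
    rcases hpos.compare h hf with hlt | ⟨rfl, hij, hf'⟩
    · have : (q : ℕ) < p := hlt
      omega
    have hij' : (i : ℕ) ≤ j := hij
    -- As `j = i`, the lower partner of `ρ` contains `σ`, so by maximality of the weight it is `σ`.
    have hji : j = i := Fin.ext (by omega)
    subst hji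
    have hface : SignFace σ (Function.update ρ j 0) := fun k => by
      by_cases hk : k = j
      · subst hk; exact Or.inl hi
      · simpa [hk] using hf' k
    have heq := hface.eq_of_signWeight_le (by omega)
    have hρ' : ρ = Function.update σ j (ρ j) := by rw [heq]; simp
    rcases h.apply_eq with h0 | h0
    · left
      rw [hρ', h0, ← hi]
      simp
    · right
      rw [hρ', h0]
  refine ⟨σ, hσ, τ, hτ, hστ, signWeight_update hi (signType_neg_one_pow_ne_zero _), hfree, ?_⟩
  refine ⟨⟨fun ω h => hS.isNormalized ω h.1, fun ω h => hS.signVar_le ω h.1, ?_⟩, ?_, ?_⟩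
  · rintro ω ⟨hω, hω'⟩ ρ hρ hf
    refine ⟨hS.mem_of_face ω hω ρ hρ hf, ?_⟩
    rintro (rfl | rfl)
    · exact hω' (hfree ω hω hf)
    · exact hω' (hfree ω hω (ProjFace.trans (Or.inl hστ) hf))
  · intro ω h1 h2 h3
    refine ⟨hS.mem_of_isLast ω h1 h2 h3, ?_⟩
    rintro (rfl | rfl)
    · exact hpos.not_isLast hp h3
    · exact hτpos.not_isLast hp h3
  · rintro ω ⟨hω, hω'⟩ q j hq h h0
    refine ⟨hS.mem_of_match ω hω q j hq h h0, ?_⟩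
    rintro (heq | heq)
    · have h1 := h.update_upper
      rw [heq] at h1
      obtain ⟨-, rfl⟩ := h1.unique hpos
      rw [← heq] at hi
      simp at hi
    · have h1 := h.update_upper
      rw [heq] at h1
      obtain ⟨rfl, rfl⟩ := h1.unique hτpos
      refine hω' (Or.inl ?_)
      have h2 := congrArg (fun f => Function.update f j 0) heq
      simp only [hτdef, Function.update_idem] at h2
      rwa [← h0, Function.update_eq_self, h0, ← hi, Function.update_eq_self] at h2

end CollapsibleFamily

/-! ### Cells in projective space -/

section SignCells

variable {n : ℕ}

theorem sign_smul_of_pos (v : Fin n → ℝ) {t : ℝ} (ht : 0 < t) (i : Fin n) :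
    SignType.sign ((t • v) i) = SignType.sign (v i) := by
  simp [sign_mul, sign_pos ht]

theorem sign_smul_of_neg (v : Fin n → ℝ) {t : ℝ} (ht : t < 0) (i : Fin n) :
    SignType.sign ((t • v) i) = - SignType.sign (v i) := by
  simp [sign_mul, _root_.sign_neg ht]

theorem mk_smul_eq (v : Fin n → ℝ) (hv : v ≠ 0) {t : ℝ} (ht : t ≠ 0) :
    Projectivization.mk ℝ (t • v) (smul_ne_zero ht hv) = Projectivization.mk ℝ v hv :=
  (Projectivization.mk_eq_mk_iff' _ _ _ _ _).mpr ⟨t, rfl⟩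

theorem signCell_neg (ω : Fin n → SignType) : signCell (-ω) = signCell ω := by
  have key : ∀ ω : Fin n → SignType, signCell ω ⊆ signCell (-ω) := by
    rintro ω p ⟨v, hv, rfl, h⟩
    refine ⟨(-1 : ℝ) • v, smul_ne_zero (by norm_num) hv, mk_smul_eq v hv (by norm_num), fun i => ?_⟩
    rw [sign_smul_of_neg v (by norm_num), h i]
    rfl
  refine Subset.antisymm ?_ (key ω)
  simpa using key (-ω)

theorem mk_mem_signCell (v : Fin n → ℝ) (hv : v ≠ 0) :
    Projectivization.mk ℝ v hv ∈ signCell fun i => SignType.sign (v i) :=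
  ⟨v, hv, rfl, fun _ => rfl⟩

theorem mk_mem_signCell_iff {v : Fin n → ℝ} {hv : v ≠ 0} {ω : Fin n → SignType} :
    Projectivization.mk ℝ v hv ∈ signCell ω ↔
      ω = (fun i => SignType.sign (v i)) ∨ ω = -(fun i => SignType.sign (v i)) := by
  constructor
  · rintro ⟨w, hw, he, hs⟩
    obtain ⟨t, rfl⟩ := (Projectivization.mk_eq_mk_iff' _ _ _ _ _).mp he
    have ht : t ≠ 0 := by rintro rfl; simp at hw
    rcases ht.lt_or_gt with h | h
    · right
      funext i
      rw [← hs i, sign_smul_of_neg v h]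
      rfl
    · left
      funext i
      rw [← hs i, sign_smul_of_pos v h]
  · rintro (rfl | rfl)
    · exact mk_mem_signCell v hv
    · rw [signCell_neg]
      exact mk_mem_signCell v hv

theorem sign_fun_ne_zero {v : Fin n → ℝ} (hv : v ≠ 0) :
    (fun i => SignType.sign (v i)) ≠ 0 := fun h => hv <| by
  funext i
  simpa using congrFun h i

theorem signCell_nonempty {ω : Fin n → SignType} (h : ω ≠ 0) : (signCell ω).Nonempty := by
  have hs : ∀ i, SignType.sign ((ω i : ℝ)) = ω i := fun i => by
    rcases SignType.trichotomy (ω i) with h | h | h <;> simp [h]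
  refine ⟨_, fun i => (ω i : ℝ), fun h0 => h ?_, rfl, hs⟩
  funext i
  rw [← hs i, congrFun h0 i]
  simp

theorem eq_or_eq_neg_of_mem_signCell {ω ω' : Fin n → SignType} {p : ℙ ℝ (Fin n → ℝ)}
    (h : p ∈ signCell ω) (h' : p ∈ signCell ω') : ω = ω' ∨ ω = -ω' := by
  induction p with | h v hv => ?_
  rw [mk_mem_signCell_iff] at h h'
  rcases h with rfl | rfl <;> rcases h' with rfl | rfl <;> simp

theorem IsNormalized.eq_of_mem_signCell {ω ω' : Fin n → SignType} (hω : IsNormalized ω)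
    (hω' : IsNormalized ω') {p : ℙ ℝ (Fin n → ℝ)} (h : p ∈ signCell ω) (h' : p ∈ signCell ω') :
    ω = ω' := by
  rcases eq_or_eq_neg_of_mem_signCell h h' with h | h
  · exact h
  · exact absurd (h ▸ hω) hω'.not_neg

/-- Every line lies in the cell of a normalized sign vector. -/
theorem exists_isNormalized_mem_signCell (p : ℙ ℝ (Fin n → ℝ)) :
    ∃ ω, IsNormalized ω ∧ p ∈ signCell ω := by
  induction p with | h v hv => ?_
  rcases isNormalized_or_neg (sign_fun_ne_zero hv) with h | h
  · exact ⟨_, h, mk_mem_signCell v hv⟩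
  · exact ⟨_, h, by rw [signCell_neg]; exact mk_mem_signCell v hv⟩

theorem mem_boundedVarGr_iff {m : ℕ} {ω : Fin n → SignType} {p : ℙ ℝ (Fin n → ℝ)}
    (h : p ∈ signCell ω) : p ∈ boundedVarGr n m ↔ signVar ω ≤ m := by
  obtain ⟨v, hv, rfl, hs⟩ := h
  have hω : ω = fun i => SignType.sign (v i) := funext fun i => (hs i).symm
  constructor
  · intro h
    rw [hω, signVar_sign]
    exact h v (Submodule.mem_span_singleton_self v)
  · intro h w hw
    obtain ⟨t, rfl⟩ := Submodule.mem_span_singleton.mp hw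
    refine le_trans ?_ h
    rw [← signVar_sign]
    rcases lt_trichotomy t 0 with ht | rfl | ht
    · rw [← signVar_neg]
      refine le_of_eq (congrArg signVar (funext fun i => ?_))
      rw [Pi.neg_apply, sign_smul_of_neg v ht, hs i, neg_neg]
    · exact SignFace.signVar_le fun i => Or.inl (by simp)
    · refine le_of_eq (congrArg signVar (funext fun i => ?_))
      rw [sign_smul_of_pos v ht, hs i]

/-- The closure of `U_ω`: the lines spanned by a vector whose sign vector is a face of `ω`. -/
def closedSignCell (ω : Fin n → SignType) : Set (ℙ ℝ (Fin n → ℝ)) :=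
  {p | ∃ (v : Fin n → ℝ) (hv : v ≠ 0),
    Projectivization.mk ℝ v hv = p ∧ SignFace (fun i => SignType.sign (v i)) ω}

theorem ProjFace.signCell_subset {σ ρ : Fin n → SignType} (h : ProjFace σ ρ) :
    signCell σ ⊆ closedSignCell ρ := by
  have key : ∀ σ : Fin n → SignType, SignFace σ ρ → signCell σ ⊆ closedSignCell ρ := by
    rintro σ h p ⟨v, hv, rfl, hs⟩
    refine ⟨v, hv, rfl, ?_⟩
    rwa [show (fun i => SignType.sign (v i)) = σ from funext hs]
  rcases h with h | h
  · exact key σ h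
  · rw [← signCell_neg]
    exact key _ h

theorem projFace_of_mem {σ ρ : Fin n → SignType} {p : ℙ ℝ (Fin n → ℝ)} (h : p ∈ signCell σ)
    (h' : p ∈ closedSignCell ρ) : ProjFace σ ρ := by
  obtain ⟨v, hv, rfl, hf⟩ := h'
  rcases mk_mem_signCell_iff.mp h with rfl | rfl
  · exact Or.inl hf
  · exact Or.inr (by simpa using hf)

end SignCells

/-! ### Affine charts and characteristic maps -/

section Charts

variable {n d : ℕ}

/-- The open solid simplex `{x | 0 < x_j, ∑ x_j < 1}`. -/
def openSimplex (d : ℕ) : Set (Fin d → ℝ) := {x | (∀ j, 0 < x j) ∧ ∑ j, x j < 1}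

theorem isOpen_openSimplex (d : ℕ) : IsOpen (openSimplex d) := by
  have : openSimplex d = (⋂ j, {x | 0 < x j}) ∩ {x | ∑ j, x j < 1} := by
    ext x; simp [openSimplex]
  rw [this]
  refine (isOpen_iInter_of_finite fun j => isOpen_lt continuous_const (continuous_apply j)).inter ?_
  exact isOpen_lt (by fun_prop) continuous_const

theorem convex_openSimplex (d : ℕ) : Convex ℝ (openSimplex d) := by
  rintro x ⟨hx, hx'⟩ y ⟨hy, hy'⟩ a b ha hb hab
  constructor
  · intro j
    have h1 := hx j
    have h2 := hy j
    simp only [Pi.add_apply, Pi.smul_apply, smul_eq_mul]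
    rcases ha.eq_or_lt with rfl | ha
    · have : b = 1 := by linarith
      subst this; simpa using h2
    · have := mul_pos ha h1
      have := mul_nonneg hb h2.le
      linarith
  · simp only [Pi.add_apply, Pi.smul_apply, smul_eq_mul, Finset.sum_add_distrib, ← Finset.mul_sum]
    rcases ha.eq_or_lt with rfl | ha
    · have : b = 1 := by linarith
      subst this; simpa using hy'
    · have := mul_lt_mul_of_pos_left hx' ha
      have := mul_le_mul_of_nonneg_left hy'.le hb
      linarith

theorem center_mem_openSimplex (d : ℕ) : (fun _ => 1 / ((d : ℝ) + 1)) ∈ openSimplex d := by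
  have : (0 : ℝ) < d + 1 := by positivity
  refine ⟨fun _ => by positivity, ?_⟩
  simp only [Finset.sum_const, Finset.card_univ, Fintype.card_fin, nsmul_eq_mul]
  rw [mul_one_div, div_lt_one this]
  linarith

theorem isBounded_openSimplex (d : ℕ) : Bornology.IsBounded (openSimplex d) := by
  refine (Metric.isBounded_Icc (0 : Fin d → ℝ) 1).subset ?_
  rintro x ⟨hx, hx'⟩
  refine ⟨fun j => (hx j).le, fun j => ?_⟩
  exact (Finset.single_le_sum (f := x) (fun k _ => (hx k).le) (Finset.mem_univ j)).trans hx'.le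

theorem closure_openSimplex (d : ℕ) :
    closure (openSimplex d) = {x | (∀ j, 0 ≤ x j) ∧ ∑ j, x j ≤ 1} := by
  apply Subset.antisymm
  · refine closure_minimal (fun x hx => ⟨fun j => (hx.1 j).le, hx.2.le⟩) ?_
    have : {x : Fin d → ℝ | (∀ j, 0 ≤ x j) ∧ ∑ j, x j ≤ 1} =
        (⋂ j, {x | 0 ≤ x j}) ∩ {x | ∑ j, x j ≤ 1} := by
      ext x; simp
    rw [this]
    exact (isClosed_iInter fun j => isClosed_le continuous_const (continuous_apply j)).inter
      (isClosed_le (by fun_prop) continuous_const)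
  · rintro x ⟨hx, hx'⟩
    set c : Fin d → ℝ := fun _ => 1 / ((d : ℝ) + 1) with hc
    obtain ⟨hc1, hc2⟩ := center_mem_openSimplex d
    -- `x` is the limit of the points `x + t (c - x)` of the open simplex as `t → 0`.
    have hlim : Filter.Tendsto (fun t : ℝ => x + t • (c - x)) (𝓝[>] 0) (𝓝 x) := by
      have : Filter.Tendsto (fun t : ℝ => x + t • (c - x)) (𝓝 0) (𝓝 (x + (0 : ℝ) • (c - x))) :=
        Continuous.tendsto (by fun_prop) 0
      rw [zero_smul, add_zero] at this
      exact this.mono_left nhdsWithin_le_nhds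
    refine mem_closure_of_tendsto hlim ?_
    filter_upwards [Ioo_mem_nhdsGT (zero_lt_one' ℝ)] with t ht
    have ht1 : 0 ≤ 1 - t := by linarith [ht.2]
    constructor
    · intro j
      have h1 := mul_nonneg ht1 (hx j)
      have h2 := mul_pos ht.1 (hc1 j)
      simp only [Pi.add_apply, Pi.smul_apply, Pi.sub_apply, smul_eq_mul, hc]
      linarith
    · simp only [Pi.add_apply, Pi.smul_apply, Pi.sub_apply, smul_eq_mul, Finset.sum_add_distrib,
        ← Finset.mul_sum, Finset.sum_sub_distrib]
      have h1 := mul_le_mul_of_nonneg_left hx' ht1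
      have h2 := mul_lt_mul_of_pos_left hc2 ht.1
      linarith

/-- The ball is convex, as is the simplex, so radial rescaling from an interior point provides a
homeomorphism between them. -/
theorem exists_cubeHomeomorph (d : ℕ) : ∃ e : (Fin d → ℝ) ≃ₜ (Fin d → ℝ),
    e '' Metric.ball 0 1 = openSimplex d ∧
      e '' Metric.closedBall 0 1 = closure (openSimplex d) := by
  obtain ⟨e, h1, h2, -⟩ := exists_homeomorph_image_interior_closure_frontier_eq_unitBall
    (convex_openSimplex d)
    (by rw [(isOpen_openSimplex d).interior_eq]; exact ⟨_, center_mem_openSimplex d⟩)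
    (isBounded_openSimplex d)
  refine ⟨e.symm, ?_, ?_⟩
  · rw [← h1, (isOpen_openSimplex d).interior_eq, ← image_comp]
    simp
  · rw [← h2, ← image_comp]
    simp

/-- A homeomorphism of `ℝ^d` taking the unit ball of the maximum norm onto the open simplex. -/
noncomputable def cubeHomeomorph (d : ℕ) : (Fin d → ℝ) ≃ₜ (Fin d → ℝ) :=
  (exists_cubeHomeomorph d).choose

/-- An enumeration of the support of a sign vector of weight `d + 1`. -/
noncomputable def supportEquiv {ω : Fin n → SignType} (hω : signWeight ω = d + 1) :
    {i // ω i ≠ 0} ≃ Fin (d + 1) :=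
  Fintype.equivFinOfCardEq (by rw [Fintype.card_subtype]; exact hω)

/-- The vector with coordinates `1 - ∑ x_j, x_1, …, x_d` on the support of `ω`, multiplied by the
signs of `ω`. For `x` in the open simplex its sign vector is `ω`. -/
noncomputable def chartVector {ω : Fin n → SignType} (hω : signWeight ω = d + 1) (x : Fin d → ℝ) :
    Fin n → ℝ := fun i =>
  if h : ω i ≠ 0 then
    (ω i : ℝ) * (Fin.cons (1 - ∑ j, x j) x : Fin (d + 1) → ℝ) (supportEquiv hω ⟨i, h⟩) else 0

theorem sign_mul_self_cast {s : SignType} (h : s ≠ 0) : (s : ℝ) * (s : ℝ) = 1 := by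
  rcases SignType.trichotomy s with rfl | rfl | rfl <;> simp at h ⊢

theorem sum_supportEquiv {ω : Fin n → SignType} (hω : signWeight ω = d + 1) (f : Fin n → ℝ)
    (hf : ∀ i, ω i = 0 → f i = 0) : ∑ j, f ((supportEquiv hω).symm j) = ∑ i, f i := by
  rw [Equiv.sum_comp (supportEquiv hω).symm (fun i => f i.1)]
  rw [← Finset.sum_subtype (Finset.univ.filter fun i => ω i ≠ 0) (by simp) f]
  rw [Finset.sum_filter]
  refine Finset.sum_congr rfl fun i _ => ?_
  by_cases h : ω i = 0 <;> simp [h, hf]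

theorem chartVector_symm {ω : Fin n → SignType} (hω : signWeight ω = d + 1) (x : Fin d → ℝ)
    (j : Fin (d + 1)) : (ω ((supportEquiv hω).symm j) : ℝ) * chartVector hω x
      ((supportEquiv hω).symm j) = (Fin.cons (1 - ∑ j, x j) x : Fin (d + 1) → ℝ) j := by
  have h := ((supportEquiv hω).symm j).2
  rw [chartVector, dif_pos h, ← mul_assoc, sign_mul_self_cast h, one_mul]
  simp

/-- The chart vectors are normalized to satisfy `∑ ω_i v_i = 1`. -/
theorem sum_chartVector {ω : Fin n → SignType} (hω : signWeight ω = d + 1) (x : Fin d → ℝ) :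
    ∑ i, (ω i : ℝ) * chartVector hω x i = 1 := by
  rw [← sum_supportEquiv hω _ fun i hi => by simp [hi]]
  simp only [chartVector_symm, Fin.sum_univ_succ, Fin.cons_zero, Fin.cons_succ]
  ring

theorem chartVector_ne_zero {ω : Fin n → SignType} (hω : signWeight ω = d + 1) (x : Fin d → ℝ) :
    chartVector hω x ≠ 0 := fun h => by
  simpa [h] using sum_chartVector hω x

theorem continuous_chartVector {ω : Fin n → SignType} (hω : signWeight ω = d + 1) :
    Continuous (chartVector hω) := by
  refine continuous_pi fun i => ?_
  unfold chartVector
  split_ifs with h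
  · refine continuous_const.mul ?_
    generalize supportEquiv hω ⟨i, h⟩ = j
    refine Fin.cases ?_ (fun j => ?_) j
    · simp only [Fin.cons_zero]; fun_prop
    · simp only [Fin.cons_succ]; fun_prop
  · exact continuous_const

/-- The affine chart of the projective subspace of the lines supported on the support of `ω`. -/
noncomputable def signChart {ω : Fin n → SignType} (hω : signWeight ω = d + 1) (x : Fin d → ℝ) :
    ℙ ℝ (Fin n → ℝ) := Projectivization.mk ℝ (chartVector hω x) (chartVector_ne_zero hω x)

theorem continuous_signChart {ω : Fin n → SignType} (hω : signWeight ω = d + 1) :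
    Continuous (signChart hω) :=
  continuous_quotient_mk'.comp ((continuous_chartVector hω).subtype_mk (chartVector_ne_zero hω))

theorem injective_signChart {ω : Fin n → SignType} (hω : signWeight ω = d + 1) :
    Function.Injective (signChart hω) := by
  intro x y h
  obtain ⟨t, ht⟩ := (Projectivization.mk_eq_mk_iff' _ _ _ _ _).mp h
  have hs := sum_chartVector hω x
  rw [← ht] at hs
  have hsum : ∑ i, (ω i : ℝ) * (t • chartVector hω y) i =
      t * ∑ i, (ω i : ℝ) * chartVector hω y i := by
    rw [Finset.mul_sum]
    exact Finset.sum_congr rfl fun i _ => by simp; ring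
  rw [hsum, sum_chartVector, mul_one] at hs
  rw [hs, one_smul] at ht
  funext j
  have h1 := chartVector_symm hω x j.succ
  have h2 := chartVector_symm hω y j.succ
  rw [Fin.cons_succ] at h1 h2
  rw [← h1, ← h2, ht]

theorem sign_chartVector {ω : Fin n → SignType} (hω : signWeight ω = d + 1) (x : Fin d → ℝ)
    (i : Fin n) (h : ω i ≠ 0) : SignType.sign (chartVector hω x i) =
      ω i * SignType.sign
        ((Fin.cons (1 - ∑ j, x j) x : Fin (d + 1) → ℝ) (supportEquiv hω ⟨i, h⟩)) := by
  rw [chartVector, dif_pos h, sign_mul]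
  congr 1
  rcases SignType.trichotomy (ω i) with h | h | h <;> simp [h]

/-- A vector whose sign vector is a face of `ω` is a positive multiple of a chart vector. -/
theorem exists_chartVector_eq {ω : Fin n → SignType} (hω : signWeight ω = d + 1) {v : Fin n → ℝ}
    (hv : v ≠ 0) (h : SignFace (fun i => SignType.sign (v i)) ω) :
    ∃ (x : Fin d → ℝ) (t : ℝ), 0 < t ∧ chartVector hω x = t • v := by
  have habs : ∀ i, (ω i : ℝ) * v i = |v i| := fun i => by
    rcases h i with h0 | h0
    · rw [sign_eq_zero_iff.mp h0]; simp
    · rw [← h0, sign_mul_self]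
  have hz : ∀ i, ω i = 0 → v i = 0 := fun i hi => by
    have := habs i
    rw [hi] at this
    simpa using this.symm
  -- The scaling factor is the inverse of `∑ |v_i| = ∑ ω_i v_i`.
  have hpos : 0 < ∑ i, |v i| := by
    obtain ⟨i, hi⟩ := Function.ne_iff.mp hv
    exact Finset.sum_pos' (fun k _ => abs_nonneg (v k)) ⟨i, Finset.mem_univ i, abs_pos.mpr hi⟩
  set s := ∑ i, |v i| with hs
  have hsum := sum_supportEquiv hω (fun i => |v i|) (fun i hi => by simp [hz i hi])
  rw [Fin.sum_univ_succ] at hsum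
  let w : Fin (d + 1) → ℝ := fun j => s⁻¹ * |v ((supportEquiv hω).symm j)|
  have hw : (Fin.cons (1 - ∑ j : Fin d, w j.succ) (fun j => w j.succ) : Fin (d + 1) → ℝ) = w := by
    funext j
    refine Fin.cases ?_ (fun j => ?_) j
    · simp only [Fin.cons_zero, w, ← Finset.mul_sum]
      rw [← hs] at hsum
      field_simp
      linarith
    · simp
  refine ⟨fun j => w j.succ, s⁻¹, inv_pos.mpr hpos, ?_⟩
  funext i
  by_cases hi : ω i = 0
  · simp [chartVector, hi, hz i hi]
  · rw [chartVector, dif_pos hi, hw]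
    simp only [w, Equiv.symm_apply_apply, Pi.smul_apply, smul_eq_mul]
    rw [← habs i]
    have := sign_mul_self_cast hi
    linear_combination s⁻¹ * v i * this

theorem cons_pos_iff {x : Fin d → ℝ} :
    (∀ j, 0 < (Fin.cons (1 - ∑ j, x j) x : Fin (d + 1) → ℝ) j) ↔ x ∈ openSimplex d := by
  rw [Fin.forall_fin_succ]
  simp only [Fin.cons_zero, Fin.cons_succ, openSimplex, Set.mem_ofPred_eq, sub_pos]
  exact and_comm

theorem cons_nonneg_iff {x : Fin d → ℝ} :
    (∀ j, 0 ≤ (Fin.cons (1 - ∑ j, x j) x : Fin (d + 1) → ℝ) j) ↔ x ∈ closure (openSimplex d) := by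
  rw [Fin.forall_fin_succ, closure_openSimplex]
  simp only [Fin.cons_zero, Fin.cons_succ, Set.mem_ofPred_eq, sub_nonneg]
  exact and_comm

theorem sign_chartVector_eq_iff {ω : Fin n → SignType} (hω : signWeight ω = d + 1) {x : Fin d → ℝ} :
    (∀ i, SignType.sign (chartVector hω x i) = ω i) ↔ x ∈ openSimplex d := by
  rw [← cons_pos_iff]
  constructor
  · intro h j
    have h2 := ((supportEquiv hω).symm j).2
    have h1 := sign_chartVector hω x _ h2
    rw [h, Subtype.coe_eta, Equiv.apply_symm_apply] at h1
    rw [← sign_eq_one_iff]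
    exact (mul_left_cancel₀ h2 (by rw [mul_one]; exact h1)).symm
  · intro h i
    by_cases hi : ω i = 0
    · simp [chartVector, hi]
    · rw [sign_chartVector hω x i hi, sign_pos (h _), mul_one]

theorem signFace_chartVector_iff {ω : Fin n → SignType} (hω : signWeight ω = d + 1)
    {x : Fin d → ℝ} :
    SignFace (fun i => SignType.sign (chartVector hω x i)) ω ↔ x ∈ closure (openSimplex d) := by
  rw [← cons_nonneg_iff]
  constructor
  · intro h j
    have h2 := ((supportEquiv hω).symm j).2
    have h1 := sign_chartVector hω x _ h2
    rw [Subtype.coe_eta, Equiv.apply_symm_apply] at h1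
    rcases h ((supportEquiv hω).symm j) with h0 | h0
    · rw [show SignType.sign (chartVector hω x _) = 0 from h0] at h1
      exact (sign_eq_zero_iff.mp ((mul_eq_zero.mp h1.symm).resolve_left h2)).ge
    · refine (sign_eq_one_iff.mp ?_).le
      exact (mul_left_cancel₀ h2 (by rw [mul_one]; exact h0.symm.trans h1)).symm
  · intro h i
    by_cases hi : ω i = 0
    · simp [chartVector, hi]
    · simp only [sign_chartVector hω x i hi]
      rcases (h (supportEquiv hω ⟨i, hi⟩)).eq_or_lt with h0 | h0
      · left; rw [← h0]; simp
      · right; rw [sign_pos h0, mul_one]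

theorem image_signChart_openSimplex {ω : Fin n → SignType} (hω : signWeight ω = d + 1) :
    signChart hω '' openSimplex d = signCell ω := by
  apply Subset.antisymm
  · rintro _ ⟨x, hx, rfl⟩
    exact ⟨_, chartVector_ne_zero hω x, rfl, (sign_chartVector_eq_iff hω).mpr hx⟩
  · rintro _ ⟨v, hv, rfl, hs⟩
    obtain ⟨x, t, ht, hx⟩ := exists_chartVector_eq hω hv fun i => Or.inr (hs i)
    refine ⟨x, (sign_chartVector_eq_iff hω).mp fun i => ?_, ?_⟩
    · rw [hx, sign_smul_of_pos v ht, hs]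
    · exact (Projectivization.mk_eq_mk_iff' _ _ _ _ _).mpr ⟨t, hx.symm⟩

theorem image_signChart_closure {ω : Fin n → SignType} (hω : signWeight ω = d + 1) :
    signChart hω '' closure (openSimplex d) = closedSignCell ω := by
  apply Subset.antisymm
  · rintro _ ⟨x, hx, rfl⟩
    exact ⟨_, chartVector_ne_zero hω x, rfl, (signFace_chartVector_iff hω).mpr hx⟩
  · rintro _ ⟨v, hv, rfl, hs⟩
    obtain ⟨x, t, ht, hx⟩ := exists_chartVector_eq hω hv hs
    refine ⟨x, (signFace_chartVector_iff hω).mp ?_, ?_⟩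
    · rw [hx]
      simpa only [sign_smul_of_pos v ht] using hs
    · exact (Projectivization.mk_eq_mk_iff' _ _ _ _ _).mpr ⟨t, hx.symm⟩

/-- The characteristic map of the cell `U_ω`, defined and injective on all of `ℝ^d`. -/
noncomputable def signCharFun {ω : Fin n → SignType} (hω : signWeight ω = d + 1) (x : Fin d → ℝ) :
    ℙ ℝ (Fin n → ℝ) := signChart hω (cubeHomeomorph d x)

theorem continuous_signCharFun {ω : Fin n → SignType} (hω : signWeight ω = d + 1) :
    Continuous (signCharFun hω) :=
  (continuous_signChart hω).comp (cubeHomeomorph d).continuous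

theorem injective_signCharFun {ω : Fin n → SignType} (hω : signWeight ω = d + 1) :
    Function.Injective (signCharFun hω) :=
  (injective_signChart hω).comp (cubeHomeomorph d).injective

theorem image_signCharFun_ball {ω : Fin n → SignType} (hω : signWeight ω = d + 1) :
    signCharFun hω '' Metric.ball 0 1 = signCell ω := by
  rw [← image_signChart_openSimplex hω, ← (exists_cubeHomeomorph d).choose_spec.1, ← image_comp]
  rfl

theorem image_signCharFun_closedBall {ω : Fin n → SignType} (hω : signWeight ω = d + 1) :
    signCharFun hω '' Metric.closedBall 0 1 = closedSignCell ω := by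
  rw [← image_signChart_closure hω, ← (exists_cubeHomeomorph d).choose_spec.2, ← image_comp]
  rfl

theorem isCompact_closedSignCell (ω : Fin n → SignType) (hω : ω ≠ 0) :
    IsCompact (closedSignCell ω) := by
  have hd : signWeight ω = (signWeight ω - 1) + 1 := by
    have := signWeight_pos hω
    omega
  rw [← image_signCharFun_closedBall hd]
  exact (isCompact_closedBall _ _).image (continuous_signCharFun hd)

/-- The inverse of a continuous injection of a compact space into a Hausdorff space is continuous
on the image of every subset. -/
theorem continuousOn_invFunOn_of_isCompact {X Y : Type*} [TopologicalSpace X] [TopologicalSpace Y]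
    [T2Space Y] [Nonempty X] {f : X → Y} {K s : Set X} (hK : IsCompact K) (hf : ContinuousOn f K)
    (hinj : InjOn f K) (hs : s ⊆ K) : ContinuousOn (Function.invFunOn f s) (f '' s) := by
  rw [continuousOn_iff_isClosed]
  intro t ht
  refine ⟨f '' (K ∩ t), ?_, ?_⟩
  · exact ((hK.inter_right ht).image_of_continuousOn (hf.mono inter_subset_left)).isClosed
  · have hl := (hinj.mono hs).leftInvOn_invFunOn
    ext y
    constructor
    · rintro ⟨h1, x, hx, rfl⟩
      rw [mem_preimage, hl hx] at h1
      exact ⟨⟨x, ⟨hs hx, h1⟩, rfl⟩, x, hx, rfl⟩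
    · rintro ⟨⟨x', hx', he⟩, x, hx, rfl⟩
      obtain rfl := hinj hx'.1 (hs hx) he
      exact ⟨by rw [mem_preimage, hl hx]; exact hx'.2, x', hx, rfl⟩

end Charts

/-! ### The CW structure -/

section CWStructure

variable {n : ℕ}

/-- The `d`-cells of the bounded sign variation space: the normalized sign vectors with `d + 1`
nonzero entries and sign variation at most `m`. -/
abbrev SignIndex (n m d : ℕ) : Type :=
  {ω : Fin n → SignType // IsNormalized ω ∧ signWeight ω = d + 1 ∧ signVar ω ≤ m}

/-- The index of the cell of a normalized sign vector. -/
def IsNormalized.index {m : ℕ} {ω : Fin n → SignType} (h : IsNormalized ω) (hm : signVar ω ≤ m) :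
    SignIndex n m (signWeight ω - 1) :=
  ⟨ω, h, by have := signWeight_pos h.ne_zero; omega, hm⟩

/-- The characteristic map of a cell, as a bijection from the open ball onto the open cell. -/
noncomputable def signCharMap {m d : ℕ} (ω : SignIndex n m d) :
    PartialEquiv (Fin d → ℝ) (ℙ ℝ (Fin n → ℝ)) :=
  (injective_signCharFun ω.2.2.1).injOn.toPartialEquiv (signCharFun ω.2.2.1) (Metric.ball 0 1)

/-- A closed cell is the union of the open cells of its faces. -/
theorem closedSignCell_eq_iUnion {ω : Fin n → SignType} :
    closedSignCell ω = ⋃ σ, ⋃ (_ : IsNormalized σ ∧ ProjFace σ ω), signCell σ := by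
  apply Subset.antisymm
  · intro p hp
    obtain ⟨σ, hσ, hpσ⟩ := exists_isNormalized_mem_signCell p
    exact mem_iUnion₂.mpr ⟨σ, ⟨hσ, projFace_of_mem hpσ hp⟩, hpσ⟩
  · exact iUnion₂_subset fun σ h => h.2.signCell_subset

theorem signCell_subset_closedSignCell (ω : Fin n → SignType) : signCell ω ⊆ closedSignCell ω :=
  ProjFace.signCell_subset (Or.inl (SignFace.refl ω))

/-- The CW structure on the bounded sign variation space with open cells `U_ω`. -/
@[reducible] noncomputable def signCW (n m : ℕ) (C : Set (ℙ ℝ (Fin n → ℝ)))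
    (hC : C = boundedVarGr n m) : CWComplex C :=
  CWComplex.mkFinite C (SignIndex n m) (fun _ ω => signCharMap ω)
    (by
      filter_upwards [Filter.eventually_ge_atTop n] with d hd
      refine ⟨fun ω => ?_⟩
      have h1 := ω.2.2.1
      have h2 : signWeight ω.1 ≤ n := (Finset.card_le_univ _).trans (by simp)
      omega)
    (fun d => inferInstance)
    (fun d ω => rfl)
    (fun d ω => (continuous_signCharFun ω.2.2.1).continuousOn)
    (fun d ω => continuousOn_invFunOn_of_isCompact (isCompact_closedBall 0 1)
      (continuous_signCharFun ω.2.2.1).continuousOn (injective_signCharFun ω.2.2.1).injOn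
      Metric.ball_subset_closedBall)
    (by
      rintro ⟨d, ω⟩ - ⟨d', ω'⟩ - hne
      change Disjoint (signCharFun ω.2.2.1 '' Metric.ball 0 1)
        (signCharFun ω'.2.2.1 '' Metric.ball 0 1)
      rw [image_signCharFun_ball, image_signCharFun_ball, Set.disjoint_left]
      intro p hp hp'
      have h := ω.2.1.eq_of_mem_signCell ω'.2.1 hp hp'
      obtain ⟨ω, h1, h2, h3⟩ := ω
      obtain ⟨ω', h1', h2', h3'⟩ := ω'
      obtain rfl : ω = ω' := h
      obtain rfl : d = d' := by omega
      exact hne rfl)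
    (by
      -- A boundary point has a sign vector which is a proper face of `ω`, hence of smaller weight.
      intro d ω x hx
      have hp : signCharFun ω.2.2.1 x ∈ closedSignCell ω.1 :=
        image_signCharFun_closedBall ω.2.2.1 ▸
          mem_image_of_mem _ (Metric.sphere_subset_closedBall hx)
      have hp' : signCharFun ω.2.2.1 x ∉ signCell ω.1 := by
        rw [← image_signCharFun_ball ω.2.2.1, (injective_signCharFun ω.2.2.1).mem_set_image]
        simp only [Metric.mem_sphere, Metric.mem_ball] at hx ⊢
        exact hx.ge.not_gt
      change signCharFun ω.2.2.1 x ∈ _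
      generalize signCharFun ω.2.2.1 x = p at hp hp'
      obtain ⟨v, hv, rfl, hf⟩ := hp
      set σ : Fin n → SignType := fun i => SignType.sign (v i)
      have hne : σ ≠ ω.1 := fun h => hp' (h ▸ mk_mem_signCell v hv)
      have hlt : signWeight σ < d + 1 := by
        rw [← ω.2.2.1]
        by_contra hle
        exact hne (hf.eq_of_signWeight_le (not_lt.mp hle))
      have hpos := signWeight_pos (sign_fun_ne_zero hv)
      -- The global sign of that face has to be adjusted before it indexes a cell.
      have key : ∀ ρ : Fin n → SignType, IsNormalized ρ → signVar ρ = signVar σ →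
          signWeight ρ = signWeight σ → Projectivization.mk ℝ v hv ∈ signCell ρ →
          Projectivization.mk ℝ v hv ∈ ⋃ (k < d) (j : SignIndex n m k),
            signCharMap j '' Metric.closedBall 0 1 := by
        intro ρ h1 h2 h3 h4
        have hρm : signVar ρ ≤ m := h2 ▸ hf.signVar_le.trans ω.2.2.2
        refine mem_iUnion₂.mpr ⟨signWeight ρ - 1, ?_, mem_iUnion.mpr ⟨h1.index hρm, ?_⟩⟩
        · have : 0 < signWeight σ := hpos
          omega
        · change _ ∈ signCharFun (h1.index hρm).2.2.1 '' Metric.closedBall 0 1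
          rw [image_signCharFun_closedBall]
          exact signCell_subset_closedSignCell ρ h4
      rcases isNormalized_or_neg (sign_fun_ne_zero hv) with h | h
      · exact key _ h rfl rfl (mk_mem_signCell v hv)
      · exact key _ h (signVar_neg _) (signWeight_neg _)
          (by rw [signCell_neg]; exact mk_mem_signCell v hv))
    (by
      subst hC
      apply Subset.antisymm
      · refine iUnion₂_subset fun d ω => ?_
        change signCharFun ω.2.2.1 '' Metric.closedBall 0 1 ⊆ _
        rw [image_signCharFun_closedBall, closedSignCell_eq_iUnion]
        exact iUnion₂_subset fun σ hσ p hp =>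
          (mem_boundedVarGr_iff hp).mpr (hσ.2.signVar_le.trans ω.2.2.2)
      · intro p hp
        obtain ⟨ω, hω, hpω⟩ := exists_isNormalized_mem_signCell p
        have hm := (mem_boundedVarGr_iff hpω).mp hp
        refine mem_iUnion₂.mpr ⟨_, hω.index hm, ?_⟩
        change p ∈ signCharFun (hω.index hm).2.2.1 '' Metric.closedBall 0 1
        rw [image_signCharFun_closedBall]
        exact signCell_subset_closedSignCell ω hpω)

theorem signCW_openCell {m d : ℕ} {C : Set (ℙ ℝ (Fin n → ℝ))} (hC : C = boundedVarGr n m)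
    (ω : SignIndex n m d) :
    letI := signCW n m C hC
    RelCWComplex.openCell (C := C) d ω = signCell ω.1 :=
  image_signCharFun_ball ω.2.2.1

theorem signCW_closedCell {m d : ℕ} {C : Set (ℙ ℝ (Fin n → ℝ))} (hC : C = boundedVarGr n m)
    (ω : SignIndex n m d) :
    letI := signCW n m C hC
    RelCWComplex.closedCell (C := C) d ω = closedSignCell ω.1 :=
  image_signCharFun_closedBall ω.2.2.1

theorem isSignDecomposition_signCW {m : ℕ} {C : Set (ℙ ℝ (Fin n → ℝ))}
    (hC : C = boundedVarGr n m) :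
    let _ := signCW n m C hC
    IsSignDecomposition m C := by
  let _ := signCW n m C hC
  refine ⟨CWComplex.finite_mkFinite C .., ?_, fun d s => ?_⟩
  · intro d ω
    exact (injective_signCharFun ω.2.2.1).injOn
  · constructor
    · rintro ⟨ω, rfl⟩
      exact ⟨ω.1, ω.2.2.1, ω.2.2.2, (signCW_openCell hC ω).symm⟩
    · rintro ⟨ω, h1, h2, rfl⟩
      have h0 : ω ≠ 0 := by
        rintro rfl
        simp [signWeight] at h1
      rcases isNormalized_or_neg h0 with h | h
      · exact ⟨(⟨ω, h, h1, h2⟩ : SignIndex n m d), signCW_openCell hC _⟩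
      · refine ⟨(⟨-ω, h, by rwa [signWeight_neg], by rwa [signVar_neg]⟩ : SignIndex n m d), ?_⟩
        rw [signCW_openCell hC]
        exact signCell_neg ω

end CWStructure

/-! ### The collapse -/

section Collapse

variable {n m : ℕ}

/-- The CW structure with cells `U_ω` on the bounded sign variation space itself. -/
@[reducible] noncomputable def boundedVarCW (n m : ℕ) : CWComplex (boundedVarGr n m) :=
  signCW n m _ rfl

attribute [local instance] boundedVarCW

theorem openCell_eq_signCell {d : ℕ} (ω : SignIndex n m d) :
    RelCWComplex.openCell (C := boundedVarGr n m) d ω = signCell ω.1 := signCW_openCell rfl ω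

theorem closedCell_eq_closedSignCell {d : ℕ} (ω : SignIndex n m d) :
    RelCWComplex.closedCell (C := boundedVarGr n m) d ω = closedSignCell ω.1 :=
  signCW_closedCell rfl ω

/-- The subcomplex formed by a family of cells closed under faces. -/
noncomputable def IsCellFamily.subcomplex {S : Set (Fin n → SignType)} (hS : IsCellFamily m S) :
    CWComplex.Subcomplex (boundedVarGr n m) :=
  CWComplex.Subcomplex.mk' (boundedVarGr n m) (⋃ ω ∈ S, signCell ω)
    (fun d => {ω : SignIndex n m d | ω.1 ∈ S})
    (by
      rintro d ⟨ω, hω⟩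
      refine (closedCell_eq_closedSignCell ω).trans_subset ?_
      rw [closedSignCell_eq_iUnion]
      exact iUnion₂_subset fun σ hσ =>
        subset_biUnion_of_mem (u := fun ω => signCell ω) (hS.mem_of_face ω.1 hω σ hσ.1 hσ.2))
    (by
      apply Subset.antisymm
      · refine iUnion₂_subset fun d ω => ?_
        refine (openCell_eq_signCell ω.1).trans_subset ?_
        exact subset_biUnion_of_mem (u := fun ω => signCell ω) ω.2
      · refine iUnion₂_subset fun ω hω p hp => ?_
        have hn := hS.isNormalized ω hω
        refine mem_iUnion₂.mpr ⟨_, ⟨hn.index (hS.signVar_le ω hω), hω⟩, ?_⟩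
        exact (openCell_eq_signCell (hn.index (hS.signVar_le ω hω))).superset hp)

theorem IsCellFamily.coe_subcomplex {S : Set (Fin n → SignType)} (hS : IsCellFamily m S) :
    (hS.subcomplex : Set (ℙ ℝ (Fin n → ℝ))) = ⋃ ω ∈ S, signCell ω := rfl

theorem sigma_signIndex_eq {d k : ℕ} {ω : SignIndex n m d} {ρ : SignIndex n m k}
    (h : ρ.1 = ω.1) : (⟨k, ρ⟩ : Σ k, SignIndex n m k) = ⟨d, ω⟩ := by
  obtain ⟨ω, h1, h2, h3⟩ := ω
  obtain ⟨ρ, h1', h2', h3'⟩ := ρ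
  obtain rfl : ρ = ω := h
  obtain rfl : k = d := by omega
  rfl

/-- Removing a free pair of sign vectors from a family of cells is an elementary collapse. -/
theorem IsCellFamily.elementaryCollapse {S : Set (Fin n → SignType)} (hS : IsCellFamily m S)
    {σ τ : Fin n → SignType} (hσ : σ ∈ S) (hτ : τ ∈ S) (hστ : SignFace σ τ)
    (hw : signWeight τ = signWeight σ + 1)
    (hfree : ∀ ρ ∈ S, ProjFace σ ρ → ρ = σ ∨ ρ = τ) (hS' : IsCellFamily m (S \ {σ, τ})) :
    ElementaryCollapse hS.subcomplex hS'.subcomplex := by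
  have hσn := hS.isNormalized σ hσ
  have hτn := hS.isNormalized τ hτ
  have hpos := signWeight_pos hσn.ne_zero
  let cσ : SignIndex n m (signWeight σ - 1) := hσn.index (hS.signVar_le σ hσ)
  let cτ : SignIndex n m (signWeight σ - 1 + 1) := ⟨τ, hτn, by omega, hS.signVar_le τ hτ⟩
  have oσ := openCell_eq_signCell cσ
  have oτ := openCell_eq_signCell cτ
  refine ⟨signWeight σ - 1, cσ, cτ, ⟨hσ, hτ, ?_, ?_⟩, ?_⟩
  · rw [oσ, closedCell_eq_closedSignCell cτ]
    exact ProjFace.signCell_subset (Or.inl hστ)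
  · intro k ρ hρ hsub
    rw [oσ, closedCell_eq_closedSignCell ρ] at hsub
    obtain ⟨p, hp⟩ := signCell_nonempty hσn.ne_zero
    rcases hfree ρ.1 hρ (projFace_of_mem hp (hsub hp)) with h | h
    · exact Or.inl (sigma_signIndex_eq h)
    · exact Or.inr (sigma_signIndex_eq h)
  · rw [oσ, oτ, hS.coe_subcomplex, hS'.coe_subcomplex]
    ext p
    simp only [mem_iUnion, Set.mem_sdiff, mem_union, exists_prop, mem_insert_iff,
      mem_singleton_iff, not_or]
    constructor
    · rintro ⟨ω, ⟨hω, h1, h2⟩, hp⟩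
      have hωn := hS.isNormalized ω hω
      exact ⟨⟨ω, hω, hp⟩, fun h => h1 (hωn.eq_of_mem_signCell hσn hp h),
        fun h => h2 (hωn.eq_of_mem_signCell hτn hp h)⟩
    · rintro ⟨⟨ω, hω, hp⟩, h1, h2⟩
      refine ⟨ω, ⟨hω, ?_, ?_⟩, hp⟩
      · rintro rfl; exact h1 hp
      · rintro rfl; exact h2 hp

/-- The subcomplex of a saturated family collapses onto the cells supported on the last `m + 1`
positions. -/
theorem IsSaturated.collapses {S : Set (Fin n → SignType)} (hS : IsSaturated m S) :
    Collapses hS.toIsCellFamily.subcomplex (isCellFamily_isLast n m).subcomplex := by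
  induction hN : S.ncard using Nat.strong_induction_on generalizing S with
  | _ N ih =>
    by_cases hne : ∃ ω ∈ S, ¬ IsLast m ω
    · obtain ⟨σ, hσ, τ, hτ, hστ, hw, hfree, hS'⟩ := hS.exists_free_pair hne
      refine Relation.ReflTransGen.head
        (hS.toIsCellFamily.elementaryCollapse hσ hτ hστ hw hfree hS'.toIsCellFamily)
        (ih _ ?_ hS' rfl)
      rw [← hN]
      exact Set.ncard_lt_ncard ⟨sdiff_subset, fun h => (h hσ).2 (Or.inl rfl)⟩ (Set.toFinite S)
    · push Not at hne
      have heq : S = {ω | IsNormalized ω ∧ signVar ω ≤ m ∧ IsLast m ω} := by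
        ext ω
        exact ⟨fun h => ⟨hS.isNormalized ω h, hS.signVar_le ω h, hne ω h⟩,
          fun h => hS.mem_of_isLast ω h.1 h.2.1 h.2.2⟩
      subst heq
      exact Relation.ReflTransGen.refl

end Collapse

/-! ### Simple-homotopy equivalence -/

section SimpleHomotopy

/-- An embedding of the ambient space of `L` into that of `K` which takes `L` onto `K` and cells
onto cells is a cellular isomorphism. -/
theorem FiniteRegularCW.iso_of_isEmbedding {K L : FiniteRegularCW} {φ : L.space → K.space}
    (hφ : IsEmbedding φ) (himage : φ '' L.complex = K.complex)
    (hKL : ∀ d (i : RelCWComplex.cell K.complex d), ∃ j : RelCWComplex.cell L.complex d,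
      RelCWComplex.openCell (C := K.complex) d i = φ '' RelCWComplex.openCell (C := L.complex) d j)
    (hLK : ∀ d (j : RelCWComplex.cell L.complex d), ∃ i : RelCWComplex.cell K.complex d,
      RelCWComplex.openCell (C := K.complex) d i =
        φ '' RelCWComplex.openCell (C := L.complex) d j) :
    Iso K L := by
  let e : L.complex ≃ₜ K.complex :=
    (hφ.homeomorphImage L.complex).trans (Homeomorph.setCongr himage)
  have hcomm : ∀ t : Set L.complex, (Subtype.val '' (e '' t) : Set K.space) =
      φ '' (Subtype.val '' t) := fun t => by
    rw [← image_comp, ← image_comp]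
    rfl
  refine ⟨e.symm, fun d s => ?_⟩
  have hs := hcomm (e.symm '' s)
  rw [e.image_symm, image_preimage_eq s e.surjective, ← e.image_symm] at hs
  rw [hs]
  constructor
  · rintro ⟨i, hi⟩
    obtain ⟨j, hj⟩ := hKL d i
    exact ⟨j, hφ.injective.image_injective (hi.trans hj)⟩
  · rintro ⟨j, hj⟩
    obtain ⟨i, hi⟩ := hLK d j
    exact ⟨i, by rw [hj, hi]⟩

variable {K : FiniteRegularCW}

theorem mem_I_of_openCell_subset {X : Type} [TopologicalSpace X] {C : Set X} [CWComplex C]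
    {E : CWComplex.Subcomplex C} {d : ℕ} {i : RelCWComplex.cell C d}
    (h : RelCWComplex.openCell (C := C) d i ⊆ E) : i ∈ E.I d := by
  by_contra hi
  exact (RelCWComplex.openCell_nonempty d i).ne_empty
    (disjoint_self.mp
      ((RelCWComplex.Subcomplex.disjoint_openCell_subcomplex_of_not_mem E hi).mono_right h))

/-- A subcomplex `E` of a complex, contained in a subcomplex `F`, as a subcomplex of `F`. -/
noncomputable def restrictSubcomplex {X : Type} [TopologicalSpace X] [T2Space X] {C : Set X}
    [CWComplex C] (F E : CWComplex.Subcomplex C) (h : (E : Set X) ⊆ F) :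
    CWComplex.Subcomplex (F : Set X) where
  carrier := E
  I d := {i | i.1 ∈ E.I d}
  closed' := E.closed
  union' := by
    rw [empty_union]
    refine Subset.antisymm ?_ ?_
    · exact iUnion₂_subset fun d i => RelCWComplex.Subcomplex.openCell_subset_of_mem E i.2
    · refine (CWComplex.Subcomplex.union (E := E)).superset.trans ?_
      refine iUnion₂_subset fun d i p hp => ?_
      have hi : i.1 ∈ F.I d := mem_I_of_openCell_subset
        ((RelCWComplex.Subcomplex.openCell_subset_of_mem E i.2).trans h)
      exact mem_iUnion₂.mpr ⟨d, ⟨⟨i.1, hi⟩, i.2⟩, hp⟩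

theorem FiniteRegularCW.collapseStep_of_elementaryCollapse {F E : CWComplex.Subcomplex K.complex}
    (h : ElementaryCollapse F E) : CollapseStep (K.ofSubcomplex F) (K.ofSubcomplex E) := by
  obtain ⟨d, σ, τ, hf, hE⟩ := h
  have hEF : (E : Set K.space) ⊆ F := hE ▸ sdiff_subset
  refine ⟨restrictSubcomplex F F subset_rfl, restrictSubcomplex F E hEF, rfl, ?_, ?_⟩
  · refine ⟨d, (⟨σ, hf.mem_left⟩ : F.I d), (⟨τ, hf.mem_right⟩ : F.I (d + 1)),
      ⟨hf.mem_left, hf.mem_right, hf.face, ?_⟩, hE⟩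
    rintro k ⟨ρ, hρ⟩ hρ' hsub
    rcases hf.free k ρ hρ hsub with h | h
    · left
      cases h
      rfl
    · right
      cases h
      rfl
  · refine iso_of_isEmbedding (φ := id) IsEmbedding.id (image_id _) ?_ ?_
    · rintro d ⟨⟨i, hi⟩, hi'⟩
      exact ⟨⟨i, hi'⟩, (image_id _).symm⟩
    · rintro d ⟨i, hi⟩
      exact ⟨⟨⟨i, mem_I_of_openCell_subset
        ((RelCWComplex.Subcomplex.openCell_subset_of_mem E hi).trans hEF)⟩, hi⟩, (image_id _).symm⟩

/-- A subcomplex is simple-homotopy equivalent to every subcomplex onto which it collapses. -/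
theorem FiniteRegularCW.simpleHomotopyEquivalent_of_collapses {F E : CWComplex.Subcomplex K.complex}
    (h : Collapses F E) : SimpleHomotopyEquivalent (K.ofSubcomplex F) (K.ofSubcomplex E) := by
  induction h with
  | refl => exact Relation.EqvGen.refl _
  | tail _ h ih =>
    exact ih.trans _ _ _ (Relation.EqvGen.rel _ _ (Or.inr (collapseStep_of_elementaryCollapse h)))

/-- A subcomplex containing all points of a complex is isomorphic to it. -/
theorem FiniteRegularCW.iso_ofSubcomplex {T : CWComplex.Subcomplex K.complex}
    (hT : (T : Set K.space) = K.complex) : Iso K (K.ofSubcomplex T) := by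
  refine iso_of_isEmbedding (φ := id) IsEmbedding.id ((image_id _).trans hT) ?_ ?_
  · intro d i
    exact ⟨⟨i, mem_I_of_openCell_subset
      ((RelCWComplex.openCell_subset_complex d i).trans hT.superset)⟩, (image_id _).symm⟩
  · rintro d ⟨i, hi⟩
    exact ⟨i, (image_id _).symm⟩

end SimpleHomotopy

/-! ### The projective subspace of the last coordinates -/

section LastCoords

/-- The sign variation of a nonzero sign vector is less than its weight, because every sign change
is determined by its right end, which is not the first nonzero position. -/
theorem signVar_lt_signWeight {n : ℕ} {ω : Fin n → SignType} (h : ω ≠ 0) :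
    signVar ω < signWeight ω := by
  classical
  have key : ∀ ω : Fin n → SignType, IsNormalized ω → signVar ω < signWeight ω := by
    rintro ω ⟨p, hp, hz⟩
    have hmem : p ∈ Finset.univ.filter fun i => ω i ≠ 0 := by simp [hp]
    refine lt_of_le_of_lt ?_ (Finset.card_erase_lt_of_mem hmem)
    rw [signVar_eq_card]
    refine Finset.card_le_card_of_injOn Prod.snd ?_ ?_
    · rintro ⟨a, b⟩ hq
      simp only [Finset.coe_filter, Finset.mem_univ, true_and, Set.mem_ofPred_eq] at hq
      simp only [Finset.coe_erase, Finset.coe_filter, Finset.mem_univ, true_and, Set.mem_sdiff,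
        Set.mem_ofPred_eq, Set.mem_singleton_iff]
      refine ⟨hq.ne_zero.2, ?_⟩
      rintro rfl
      exact hq.ne_zero.1 (hz a hq.1)
    · rintro ⟨a, b⟩ hq ⟨a', b'⟩ hr hqr
      simp only [Finset.coe_filter, Finset.mem_univ, true_and, Set.mem_ofPred_eq] at hq hr
      obtain rfl : b = b' := hqr
      rcases lt_trichotomy a a' with hlt | rfl | hlt
      · exact absurd (hq.2.2 a' hlt hr.1) hr.ne_zero.1
      · rfl
      · exact absurd (hr.2.2 a hlt hq.1) hq.ne_zero.1
  rcases isNormalized_or_neg h with h | h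
  · exact key ω h
  · rw [← signVar_neg, ← signWeight_neg]
    exact key _ h

theorem signVar_le_of_succ {m : ℕ} (ω : Fin (m + 1) → SignType) : signVar ω ≤ m := by
  have key : ∀ ω : Fin (m + 1) → SignType, ω ≠ 0 → signVar ω ≤ m := fun ω h0 => by
    have h1 := signVar_lt_signWeight h0
    have h2 : signWeight ω ≤ m + 1 := (Finset.card_le_univ _).trans (by simp)
    omega
  rcases eq_or_ne ω 0 with rfl | h0
  · exact (SignFace.signVar_le (ρ := fun _ => 1) fun _ => Or.inl rfl).trans
      (key _ fun h => one_ne_zero (congrFun h 0))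
  · exact key ω h0

theorem univ_eq_boundedVarGr (m : ℕ) : (Set.univ : Set (RP m)) = boundedVarGr (m + 1) m := by
  refine (Set.eq_univ_of_forall fun p => ?_).symm
  obtain ⟨ω, -, hp⟩ := exists_isNormalized_mem_signCell p
  exact (mem_boundedVarGr_iff hp).mpr (signVar_le_of_succ ω)

instance compactSpace_realProjectiveSpace {n : ℕ} : CompactSpace (ℙ ℝ (Fin n → ℝ)) := by
  refine ⟨?_⟩
  have : (Set.univ : Set (ℙ ℝ (Fin n → ℝ))) =
      ⋃ ω : {ω : Fin n → SignType // ω ≠ 0}, closedSignCell ω.1 := by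
    refine (Set.eq_univ_of_forall fun p => ?_).symm
    obtain ⟨ω, hω, hp⟩ := exists_isNormalized_mem_signCell p
    exact mem_iUnion.mpr ⟨⟨ω, hω.ne_zero⟩, signCell_subset_closedSignCell ω hp⟩
  rw [this]
  exact isCompact_iUnion fun ω => isCompact_closedSignCell ω.1 ω.2

variable {n m : ℕ}

/-- The position of the `j`-th of the last `m + 1` coordinates. -/
def lastIndex (h : m < n) (j : Fin (m + 1)) : Fin n := ⟨n - (m + 1) + j, by omega⟩

theorem lastIndex_injective (h : m < n) : Function.Injective (lastIndex h) := fun a b hab => by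
  have := congrArg Fin.val hab
  simp only [lastIndex] at this
  exact Fin.ext (by omega)

theorem exists_lastIndex_eq (h : m < n) {i : Fin n} (hi : ¬ (i : ℕ) + m + 1 < n) :
    ∃ j, lastIndex h j = i :=
  ⟨⟨i + (m + 1) - n, by omega⟩, Fin.ext (by simp only [lastIndex]; omega)⟩

theorem not_lt_lastIndex (h : m < n) (j : Fin (m + 1)) : ¬ (lastIndex h j : ℕ) + m + 1 < n := by
  simp only [lastIndex]
  omega

theorem lastCoords_lastIndex (h : m < n) (y : Fin (m + 1) → ℝ) (j : Fin (m + 1)) :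
    lastCoords n m y (lastIndex h j) = y j := by
  have h1 : n ≤ n - (m + 1) + (j : ℕ) + (m + 1) := by omega
  have h2 : n - (m + 1) + (j : ℕ) + (m + 1) - n = j := by omega
  simp [lastCoords, lastIndex, h1, h2]

theorem lastCoords_eq_zero (y : Fin (m + 1) → ℝ) {i : Fin n} (hi : (i : ℕ) + m + 1 < n) :
    lastCoords n m y i = 0 := by
  have : ¬ n ≤ (i : ℕ) + (m + 1) := by omega
  simp [lastCoords, this]

/-- The cells of `ℝP^m` are taken onto the cells whose sign vector is supported on the last
`m + 1` positions. -/
theorem image_rpInclusion_signCell (h : m < n) {ω : Fin n → SignType} (hω : IsLast m ω) :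
    rpInclusion h '' signCell (fun j => ω (lastIndex h j)) = signCell ω := by
  apply Subset.antisymm
  · rintro _ ⟨_, ⟨y, hy, rfl, hs⟩, rfl⟩
    refine ⟨lastCoords n m y, (map_ne_zero_iff _ (lastCoords_injective h)).mpr hy, rfl, fun i => ?_⟩
    by_cases hi : (i : ℕ) + m + 1 < n
    · rw [lastCoords_eq_zero y hi, hω i hi, sign_zero]
    · obtain ⟨j, rfl⟩ := exists_lastIndex_eq h hi
      rw [lastCoords_lastIndex, hs]
  · rintro _ ⟨v, hv, rfl, hs⟩
    have hv' : lastCoords n m (fun j => v (lastIndex h j)) = v := by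
      funext i
      by_cases hi : (i : ℕ) + m + 1 < n
      · rw [lastCoords_eq_zero _ hi]
        have := hs i
        rw [hω i hi, sign_eq_zero_iff] at this
        exact this.symm
      · obtain ⟨j, rfl⟩ := exists_lastIndex_eq h hi
        rw [lastCoords_lastIndex]
    have hne : (fun j => v (lastIndex h j)) ≠ 0 := fun h0 => hv (by rw [← hv', h0, map_zero])
    refine ⟨Projectivization.mk ℝ _ hne, ⟨_, hne, rfl, fun j => hs _⟩, ?_⟩
    unfold rpInclusion
    rw [Projectivization.map_mk]
    congr 1

theorem signWeight_comp_lastIndex (h : m < n) {ω : Fin n → SignType} (hω : IsLast m ω) :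
    signWeight (fun j => ω (lastIndex h j)) = signWeight ω := by
  unfold signWeight
  rw [← Finset.card_map ⟨lastIndex h, lastIndex_injective h⟩]
  congr 1
  ext i
  simp only [Finset.mem_map, Finset.mem_filter, Finset.mem_univ, true_and,
    Function.Embedding.coeFn_mk]
  constructor
  · rintro ⟨j, hj, rfl⟩
    exact hj
  · intro hi
    obtain ⟨j, rfl⟩ := exists_lastIndex_eq h fun hlt => hi (hω i hlt)
    exact ⟨j, hi, rfl⟩

/-- Every sign vector on `m + 1` positions extends by zero. -/
theorem exists_isLast_comp_lastIndex_eq (h : m < n) (ω : Fin (m + 1) → SignType) :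
    ∃ ω' : Fin n → SignType, IsLast m ω' ∧ (fun j => ω' (lastIndex h j)) = ω := by
  classical
  refine ⟨Function.extend (lastIndex h) ω 0, fun i hi => ?_, ?_⟩
  · refine Function.extend_apply' _ _ _ ?_
    rintro ⟨j, rfl⟩
    exact not_lt_lastIndex h j hi
  · exact funext fun j => (lastIndex_injective h).extend_apply _ _ j

theorem IsLast.signVar_le (h : m < n) {ω : Fin n → SignType} (hω : IsLast m ω) (h0 : ω ≠ 0) :
    signVar ω ≤ m := by
  have h1 := signVar_lt_signWeight h0
  have h2 : signWeight (fun j => ω (lastIndex h j)) ≤ m + 1 :=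
    (Finset.card_le_univ _).trans (by simp)
  rw [signWeight_comp_lastIndex h hω] at h2
  omega

theorem isEmbedding_rpInclusion (h : m < n) : IsEmbedding (rpInclusion h) := by
  refine (Continuous.isClosedEmbedding ?_ (Projectivization.map_injective _ _)).isEmbedding
  refine Continuous.quotient_map' (f := fun v : {v : Fin (m + 1) → ℝ // v ≠ 0} =>
    (⟨lastCoords n m v.1, (map_ne_zero_iff _ (lastCoords_injective h)).mpr v.2⟩ :
      {v : Fin n → ℝ // v ≠ 0})) ?_ _
  exact ((LinearMap.continuous_of_finiteDimensional _).comp continuous_subtype_val).subtype_mk _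

theorem range_rpInclusion (h : m < n) : Set.range (rpInclusion h) =
    ⋃ ω ∈ {ω : Fin n → SignType | IsNormalized ω ∧ signVar ω ≤ m ∧ IsLast m ω}, signCell ω := by
  apply Subset.antisymm
  · rintro _ ⟨p, rfl⟩
    obtain ⟨ω', -, hp⟩ := exists_isNormalized_mem_signCell p
    obtain ⟨ω, hω, rfl⟩ := exists_isLast_comp_lastIndex_eq h ω'
    have hp' := image_rpInclusion_signCell h hω ▸ mem_image_of_mem (rpInclusion h) hp
    obtain ⟨ρ, hρ, hpρ⟩ := exists_isNormalized_mem_signCell (rpInclusion h p)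
    have hρl : IsLast m ρ := by
      rcases eq_or_eq_neg_of_mem_signCell hpρ hp' with rfl | rfl
      · exact hω
      · exact fun k hk => by simp [hω k hk]
    exact mem_iUnion₂.mpr ⟨ρ, ⟨hρ, hρl.signVar_le h hρ.ne_zero, hρl⟩, hpρ⟩
  · refine iUnion₂_subset fun ω hω => ?_
    rw [← image_rpInclusion_signCell h hω.2.2]
    exact image_subset_range _ _

end LastCoords

/-! ### Collapse and simple-homotopy equivalence of the bounded sign variation space -/

theorem mainTheorem2 (n m : ℕ) (h : m < n) :
    ∃ (cwG : CWComplex (boundedVarGr n m)) (cwP : CWComplex (Set.univ : Set (RP m)))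
      (hG : IsSignDecomposition m (boundedVarGr n m))
      (hP : IsSignDecomposition m (Set.univ : Set (RP m))),
      (IsEmbedding (rpInclusion h) ∧
        ∃ T E : CWComplex.Subcomplex (boundedVarGr n m),
          (T : Set (ℙ ℝ (Fin n → ℝ))) = boundedVarGr n m ∧
          (E : Set (ℙ ℝ (Fin n → ℝ))) = Set.range (rpInclusion h) ∧
          (∀ (d : ℕ) (i : RelCWComplex.cell (Set.univ : Set (RP m)) d),
            ∃ j ∈ E.I d, rpInclusion h '' RelCWComplex.openCell (C := Set.univ) d i =
              RelCWComplex.openCell (C := boundedVarGr n m) d j) ∧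
          Collapses T E) ∧
      FiniteRegularCW.SimpleHomotopyEquivalent hG.toFiniteRegularCW hP.toFiniteRegularCW := by
  let cwG : CWComplex (boundedVarGr n m) := boundedVarCW n m
  let cwP : CWComplex (Set.univ : Set (RP m)) := signCW (m + 1) m _ (univ_eq_boundedVarGr m)
  have hG : IsSignDecomposition m (boundedVarGr n m) := isSignDecomposition_signCW rfl
  have hP : IsSignDecomposition m (Set.univ : Set (RP m)) :=
    isSignDecomposition_signCW (univ_eq_boundedVarGr m)
  let T : CWComplex.Subcomplex (boundedVarGr n m) := (isSaturated_all n m).toIsCellFamily.subcomplex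
  let E : CWComplex.Subcomplex (boundedVarGr n m) := (isCellFamily_isLast n m).subcomplex
  have hT : (T : Set (ℙ ℝ (Fin n → ℝ))) = boundedVarGr n m := by
    refine Subset.antisymm (RelCWComplex.Subcomplex.subset_complex T) fun p hp => ?_
    obtain ⟨ω, hω, hpω⟩ := exists_isNormalized_mem_signCell p
    exact mem_iUnion₂.mpr ⟨ω, ⟨hω, (mem_boundedVarGr_iff hpω).mp hp⟩, hpω⟩
  have hE : (E : Set (ℙ ℝ (Fin n → ℝ))) = Set.range (rpInclusion h) := (range_rpInclusion h).symm
  have hcell : ∀ (d : ℕ) (i : RelCWComplex.cell (Set.univ : Set (RP m)) d),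
      ∃ j ∈ E.I d, rpInclusion h '' RelCWComplex.openCell (C := Set.univ) d i =
        RelCWComplex.openCell (C := boundedVarGr n m) d j := by
    intro d i
    obtain ⟨ω', hw, -, hi⟩ := (hP.openCell_iff d _).mp ⟨i, rfl⟩
    obtain ⟨ω, hω, rfl⟩ := exists_isLast_comp_lastIndex_eq h ω'
    rw [signWeight_comp_lastIndex h hω] at hw
    have h0 : ω ≠ 0 := by
      rintro rfl
      simp [signWeight] at hw
    obtain ⟨j, hj⟩ := (hG.openCell_iff d _).mpr ⟨ω, hw, hω.signVar_le h h0, rfl⟩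
    have himg := image_rpInclusion_signCell h hω
    refine ⟨j, mem_I_of_openCell_subset ?_, by rw [← hi, himg, hj]⟩
    rw [hj, hE, ← himg]
    exact image_subset_range _ _
  have hTE : Collapses T E := (isSaturated_all n m).collapses
  refine ⟨cwG, cwP, hG, hP,
    ⟨isEmbedding_rpInclusion h, T, E, hT, hE, hcell, hTE⟩, ?_⟩
  have h1 : FiniteRegularCW.SimpleHomotopyEquivalent hG.toFiniteRegularCW
      (hG.toFiniteRegularCW.ofSubcomplex T) :=
    Relation.EqvGen.rel _ _ (Or.inl (FiniteRegularCW.iso_ofSubcomplex hT))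
  have h2 : FiniteRegularCW.SimpleHomotopyEquivalent (hG.toFiniteRegularCW.ofSubcomplex T)
      (hG.toFiniteRegularCW.ofSubcomplex E) :=
    FiniteRegularCW.simpleHomotopyEquivalent_of_collapses hTE
  have h3 : FiniteRegularCW.Iso (hG.toFiniteRegularCW.ofSubcomplex E) hP.toFiniteRegularCW := by
    refine FiniteRegularCW.iso_of_isEmbedding (φ := rpInclusion h) (isEmbedding_rpInclusion h)
      (image_univ.trans hE.symm) ?_ ?_
    · rintro d ⟨ω, hω⟩
      obtain ⟨j, hj⟩ := (hP.openCell_iff d _).mpr ⟨fun j => ω.1 (lastIndex h j),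
        (signWeight_comp_lastIndex h hω.2.2).trans ω.2.2.1, signVar_le_of_succ _, rfl⟩
      refine ⟨j, (openCell_eq_signCell ω).trans ?_⟩
      rw [← image_rpInclusion_signCell h hω.2.2]
      exact congrArg _ hj.symm
    · intro d j
      obtain ⟨i, hi, hij⟩ := hcell d j
      exact ⟨⟨i, hi⟩, hij.symm⟩
  exact (h1.trans _ _ _ h2).trans _ _ _ (Relation.EqvGen.rel _ _ (Or.inl h3))
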